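/- **Setting.** Fix integers $K,n$, a compact set $\Theta\subset(\mathbb R^{n\times n}\times\mathbb R^n)^K$, a convex compact set $\Pi\subset\mathbb R^n$, and $\sigma_w>0$. A model consists of a parameter $\theta=(A_k,b_k)_{k=1}^K$, a $K\times K$ transition matrix $P=(p_{i,j})$, an initial distribution on $\{1,\dots,K\}$, and probability distributions $f_1,\dots,f_K$ on $\mathbb R^n$. The states $s_0,s_1,\dots$ form a Markov chain with this initial distribution and transition matrix $P$; the output at time $t\ge 1$ for input $x_t$ is $y_t=A_{s_t}x_t+b_{s_t}+w_t$, where, given the states, the $w_t$ are independent with $w_t\sim f_{s_t}$. The stage cost is minus the expected revenue, $$\mathcal J(i,x)=\mathbb E(-x\cdot y_t\mid s_{t-1}=i,\ x_t=x),$$ and its minimizer, the optimal input after state $i$, is $x_i^*=-\big(\sum_j p_{i,j}(A_j+A_j^{\mathsf T})\big)^{-1}\sum_j p_{i,j}b_j$. The model is admissible if $\theta\in\Theta$, every $A_k$ is negative definite (not necessarily symmetric), every $f_k$ has mean zero and coordinate variances at most $\sigma_w^2$, and $x_i^*\in\Pi$ for all $i$. **Policy.** MSPSA has parameters $\gamma_i,\gamma_i'>0$,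 integers $N_i,N_i'\ge0$, initial estimates $\hat x_{i,1}\in\Pi$, and a distribution $\nu$ on $\mathbb R$ that is symmetric around $0$ and satisfies $|\Delta|\le\xi_1$ almost surely and $\mathbb E(1/\Delta^2)\le\xi_2$ for $\Delta\sim\nu$, where $\xi_1,\xi_2>0$. For each $i$ and $k\ge1$ let $\Delta_{i,k}\in\mathbb R^n$ be random vectors, all of whose entries (over all $i,k$) are i.i.d. with law $\nu$ and independent of the states and the noise; let $\bar\Delta_{i,k}$ be the entrywise inverse of $\Delta_{i,k}$, and put $a_{i,k}=\gamma_i/(N_i+k)$, $c_{i,k}=\gamma_i'/(N_i'+k)^{1/4}$. At the $(2k-1)$-th time $t$ with $s_{t-1}=i$ the input is $x_t=\hat x_{i,k}+c_{i,k}\Delta_{i,k}$, and one stores $d^+_{i,k}=-x_t\cdot y_t$; at the $2k$-th such time the input is $x_t=\hat x_{i,k}-c_{i,k}\Delta_{i,k}$, with $d^-_{i,k}=-x_t\cdot y_t$, after which $\hat x_{i,k+1}$ is the Euclidean projection onto $\Pi$ of $$\hat x_{i,k}-a_{i,k}\,\frac{d^+_{i,k}-d^-_{i,k}}{c_{i,k}}\,\bar\Delta_{i,k}.$$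 **Theorem.** For every admissible model and every $T$, the cost difference $\sum_{t=1}^T\big(\mathcal J(s_{t-1},x_t)-\mathcal J(s_{t-1},x^*_{s_{t-1}})\big)$ of MSPSA is integrable. Moreover there are constants $C,C'>0$ (which may depend on $K,n,\Theta,\Pi,\sigma_w,\xi_1,\xi_2$ and the parameters of MSPSA, but not on $T$ or on the model) such that for all $T$ $$\sup\ \mathbb E\Big(\sum_{t=1}^T\|x_t-x^*_{s_{t-1}}\|_2^2\Big)\le C\sqrt T,\qquad \sup\ \mathbb E\Big(\sum_{t=1}^T\mathcal J(s_{t-1},x_t)-\sum_{t=1}^T\mathcal J(s_{t-1},x^*_{s_{t-1}})\Big)\le C'\sqrt T,$$ where both suprema are taken over all admissible models such that $$\gamma_i\ \ge\ \frac{1}{8\,\lambda_{\min}\!\big(-\sum_j p_{i,j}(A_j+A_j^{\mathsf T})/2\big)}\qquad\text{for every } i\in\{1,\dots,K\}.$$ -/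

import Mathlib

open MeasureTheory ProbabilityTheory
open scoped ENNReal

noncomputable section

/-- Prices and demands: `ℝⁿ` with the Euclidean norm. -/
abbrev Vec (n : ℕ) : Type := EuclideanSpace ℝ (Fin n)

/-- The system parameter `θ = (A_k, b_k)_{k = 1, …, K}` of a Markov jump affine model with equal
input and output dimension `n`. -/
abbrev Params (K n : ℕ) : Type := Fin K → Matrix (Fin n) (Fin n) ℝ × Vec n

/-- A model instance: the parameter `θ`, the transition matrix `P`, the law of the initial state
`s₀`, and the noise distributions `f_k`. -/
structure Model (K n : ℕ) where
  θ : Params K n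
  P : Matrix (Fin K) (Fin K) ℝ
  init : Fin K → ℝ
  f : Fin K → Measure (Vec n)

/-- Euclidean projection onto a set `D`: a point of `D` nearest to `x`. -/
def euclProj {n : ℕ} (D : Set (Vec n)) (x : Vec n) : Vec n :=
  open Classical in
  if h : ∃ y ∈ D, ∀ z ∈ D, ‖x - y‖ ≤ ‖x - z‖ then h.choose else x

/-- Minimum eigenvalue of a (symmetric) real matrix. -/
def minEigenvalue {n : ℕ} (M : Matrix (Fin n) (Fin n) ℝ) : ℝ :=
  sInf (spectrum ℝ M)

/-- Negative definiteness of a real matrix that need not be symmetric. -/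
def NegDefinite {n : ℕ} (A : Matrix (Fin n) (Fin n) ℝ) : Prop :=
  ∀ x : Vec n, x ≠ 0 → inner ℝ x (A.toEuclideanLin x) < 0

namespace Model

variable {K n : ℕ} (I : Model K n)

/-- The matrix `A_k`. -/
def A (k : Fin K) : Matrix (Fin n) (Fin n) ℝ := (I.θ k).1

/-- The vector `b_k`. -/
def b (k : Fin K) : Vec n := (I.θ k).2

/-- The output `y = A_k x + b_k + w` in state `k`, for input `x` and noise `w`. -/
def output (k : Fin K) (x w : Vec n) : Vec n :=
  (I.A k).toEuclideanLin x + I.b k + w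

/-- The stage cost `𝔼(- x ⬝ y_t | s_{t-1} = i, x_t = x)`: the next state `j` has probability
`p_{i,j}`, and given `j` the noise has law `f_j`. -/
def stageCost (i : Fin K) (x : Vec n) : ℝ :=
  ∑ j, I.P i j * ∫ w, -inner ℝ x (I.output j x w) ∂(I.f j)

/-- The optimal input `x_i^* = -(∑_j p_{i,j} (A_j + A_jᵀ))⁻¹ (∑_j p_{i,j} b_j)` after observing
state `i`. -/
def optInput (i : Fin K) : Vec n :=
  -((∑ j, I.P i j • (I.A j + (I.A j).transpose))⁻¹.toEuclideanLin (∑ j, I.P i j • I.b j))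

/-- The standing assumptions: `θ` lies in the set `Θ`, all `A_k` are negative definite, `P` is a
transition matrix, the noise is centred with coordinate variances at most `σw²`, and `D` contains
the optimal inputs. -/
structure Admissible (Θ : Set (Params K n)) (D : Set (Vec n)) (σw : ℝ) : Prop where
  θ_mem : I.θ ∈ Θ
  negDef : ∀ k, NegDefinite (I.A k)
  stochastic : I.P ∈ Matrix.rowStochastic ℝ (Fin K)
  init_mem : I.init ∈ stdSimplex ℝ (Fin K)
  noise_prob : ∀ k, IsProbabilityMeasure (I.f k)
  noise_memLp : ∀ k l, MemLp (fun w : Vec n => w l) 2 (I.f k)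
  noise_mean : ∀ k l, ∫ w, w l ∂(I.f k) = 0
  noise_var : ∀ k l, ∫ w, w l ^ 2 ∂(I.f k) ≤ σw ^ 2
  optInput_mem : ∀ i, I.optInput i ∈ D

end Model

/-- The parameters of the MSPSA policy: gain constants `γ_i, γ'_i, N_i, N'_i`, initial estimates
`x̂_{i,1}`, and the common distribution `ν` of the entries of the perturbation vectors. -/
structure MSPSA (K n : ℕ) where
  γ : Fin K → ℝ
  γ' : Fin K → ℝ
  N : Fin K → ℕ
  N' : Fin K → ℕ
  xInit : Fin K → Vec n
  ν : Measure ℝ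

/-- The memory of MSPSA: for every state `i`, the counter `t_i`, the flag `e_i`, the most recent
estimate of the optimal input, and the stored cost `d_i⁺`. -/
structure MSPSA.Memory (K n : ℕ) where
  count : Fin K → ℕ
  flag : Fin K → Bool
  est : Fin K → Vec n
  dPlus : Fin K → ℝ

namespace MSPSA

variable {K n : ℕ} (p : MSPSA K n)

/-- The requirements on the parameters of MSPSA. The expectation of `1 / Δ²` is taken in `[0, ∞]`
with `1 / 0 = ∞`. -/
structure Valid (D : Set (Vec n)) (ξ₁ ξ₂ : ℝ) : Prop where
  γ_pos : ∀ i, 0 < p.γ i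
  γ'_pos : ∀ i, 0 < p.γ' i
  xInit_mem : ∀ i, p.xInit i ∈ D
  ν_prob : IsProbabilityMeasure p.ν
  ν_symm : p.ν.map (fun x => -x) = p.ν
  ν_bdd : ∀ᵐ x ∂p.ν, |x| ≤ ξ₁
  ν_inv : ∫⁻ x, (ENNReal.ofReal (x ^ 2))⁻¹ ∂p.ν ≤ ENNReal.ofReal ξ₂

/-- The step size `a_k = γ_i / (N_i + k)`. -/
def stepGain (i : Fin K) (k : ℕ) : ℝ := p.γ i / ((p.N i : ℝ) + k)

/-- The perturbation gain `c_k = γ'_i / (N'_i + k)^{1/4}`. -/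
def pertGain (i : Fin K) (k : ℕ) : ℝ := p.γ' i / ((p.N' i : ℝ) + k) ^ (1 / 4 : ℝ)

/-- The memory before the first stage. -/
def initMemory : Memory K n where
  count := fun _ => 0
  flag := fun _ => false
  est := p.xInit
  dPlus := fun _ => 0

/-- The input chosen after observing state `i`; `δ i k` is the `k`-th perturbation vector drawn
for state `i`. -/
def input (m : Memory K n) (δ : Fin K → ℕ → Vec n) (i : Fin K) : Vec n :=
  if m.flag i then m.est i - p.pertGain i (m.count i) • δ i (m.count i)
  else m.est i + p.pertGain i (m.count i + 1) • δ i (m.count i + 1)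

/-- The memory after a stage in which the previous state was `i` and the output was `y`. -/
def update (D : Set (Vec n)) (m : Memory K n) (δ : Fin K → ℕ → Vec n) (i : Fin K) (y : Vec n) :
    Memory K n :=
  let x := p.input m δ i
  if m.flag i then
    let k := m.count i
    let dMinus : ℝ := -inner ℝ x y
    let δInv : Vec n := WithLp.toLp 2 fun l => 1 / δ i k l
    { m with
      flag := Function.update m.flag i false
      est := Function.update m.est i
        (euclProj D
          (m.est i - (p.stepGain i k * ((m.dPlus i - dMinus) / p.pertGain i k)) • δInv)) }
  else
    { m with
      count := Function.update m.count i (m.count i + 1)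
      flag := Function.update m.flag i true
      dPlus := Function.update m.dPlus i (-inner ℝ x y) }

/-- The memory after `t` stages, along the state sequence `s`, noise sequence `w` and perturbation
vectors `δ`. Stage `t + 1` observes `s t`, chooses the input, and then sees the output in state
`s (t + 1)` with noise `w (t + 1)`. -/
def memory (D : Set (Vec n)) (I : Model K n) (s : ℕ → Fin K) (w : ℕ → Vec n)
    (δ : Fin K → ℕ → Vec n) : ℕ → Memory K n
  | 0 => p.initMemory
  | t + 1 =>
    let m := memory D I s w δ t
    p.update D m δ (s t) (I.output (s (t + 1)) (p.input m δ (s t)) (w (t + 1)))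

end MSPSA

/-- A probability space carrying the states `s₀, s₁, …`, the noise `w₁, w₂, …` and the
perturbation vectors. The states form a Markov chain with initial law `init` and transition matrix
`P`; given the states, the `w_t` are independent with laws `f_{s_t}`; the entries of the
perturbation vectors are i.i.d. with law `ν` and independent of the states and the noise. The
variable `w 0` plays no role. -/
structure Realization {K n : ℕ} (I : Model K n) (ν : Measure ℝ) where
  Ω : Type
  [mΩ : MeasurableSpace Ω]
  μ : Measure Ω
  prob : IsProbabilityMeasure μ
  s : ℕ → Ω → Fin K
  w : ℕ → Ω → Vec n
  δ : Fin K → ℕ → Ω → Vec n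
  meas_s : ∀ t, Measurable (s t)
  meas_w : ∀ t, Measurable (w t)
  meas_δ : ∀ i k, Measurable (δ i k)
  law : ∀ (T : ℕ) (j : ℕ → Fin K) (B : ℕ → Set (Vec n)), (∀ t, MeasurableSet (B t)) →
    μ ({ω | ∀ t ≤ T, s t ω = j t} ∩ {ω | ∀ t < T, w (t + 1) ω ∈ B (t + 1)}) =
      ENNReal.ofReal (I.init (j 0)) *
        ∏ t ∈ Finset.range T,
          (ENNReal.ofReal (I.P (j t) (j (t + 1))) * I.f (j (t + 1)) (B (t + 1)))
  δ_law : ∀ i k l, μ.map (fun ω => δ i k ω l) = ν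
  δ_indep : iIndepFun (fun (q : Fin K × ℕ × Fin n) ω => δ q.1 q.2.1 ω q.2.2) μ
  δ_indep_system :
    IndepFun (fun ω (i : Fin K) (k : ℕ) => δ i k ω) (fun ω => (fun t => s t ω, fun t => w t ω)) μ

attribute [instance] Realization.mΩ

namespace Realization

variable {K n : ℕ} {I : Model K n}

/-- The MSPSA input `x_{t+1}`, which is chosen after observing `s_t`. -/
def input {p : MSPSA K n} (R : Realization I p.ν) (D : Set (Vec n)) (t : ℕ) (ω : R.Ω) : Vec n :=
  p.input
    (p.memory D I (fun r => R.s r ω) (fun r => R.w r ω) (fun i k => R.δ i k ω) t)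
    (fun i k => R.δ i k ω) (R.s t ω)

/-- The cumulative input-MSE `𝔼 ∑_{t=1}^T ‖x_t - x^*_{s_{t-1}}‖²` of MSPSA, in `[0, ∞]`. -/
def inputMSE {p : MSPSA K n} (R : Realization I p.ν) (D : Set (Vec n)) (T : ℕ) : ℝ≥0∞ :=
  ∫⁻ ω, ∑ t ∈ Finset.range T, ‖R.input D t ω - I.optInput (R.s t ω)‖ₑ ^ 2 ∂(R.μ)

/-- The realized cost difference `∑_{t=1}^T J(s_{t-1}, x_t) - ∑_{t=1}^T J(s_{t-1}, x_t^*)`. -/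
def costGap {p : MSPSA K n} (R : Realization I p.ν) (D : Set (Vec n)) (T : ℕ) (ω : R.Ω) : ℝ :=
  ∑ t ∈ Finset.range T, I.stageCost (R.s t ω) (R.input D t ω) -
    ∑ t ∈ Finset.range T, I.stageCost (R.s t ω) (I.optInput (R.s t ω))

/-- The cumulative regret of MSPSA over the horizon `T`. -/
def regret {p : MSPSA K n} (R : Realization I p.ν) (D : Set (Vec n)) (T : ℕ) : ℝ :=
  ∫ ω, R.costGap D T ω ∂(R.μ)

end Realization

namespace MSPSA

variable {K n : ℕ} (p : MSPSA K n)

/-- The step size condition `γ_i ≥ 1 / (8 λ_min(-∑_j p_{i,j} (A_j + A_jᵀ) / 2))` for all `i`. -/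
def StepCondition (I : Model K n) : Prop :=
  ∀ i, 1 / (8 * minEigenvalue
    (-∑ j, I.P i j • ((1 / 2 : ℝ) • (I.A j + (I.A j).transpose)))) ≤ p.γ i

/-- The worst-case cumulative input-MSE of MSPSA over a class `𝒞` of models. -/
def worstInputMSE (D : Set (Vec n)) (𝒞 : Set (Model K n)) (T : ℕ) : ℝ≥0∞ :=
  ⨆ I ∈ 𝒞, ⨆ R : Realization I p.ν, R.inputMSE D T

/-- The worst-case regret of MSPSA over a class `𝒞` of models. -/
def worstRegret (D : Set (Vec n)) (𝒞 : Set (Model K n)) (T : ℕ) : EReal :=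
  ⨆ I ∈ 𝒞, ⨆ R : Realization I p.ν, ((R.regret D T : ℝ) : EReal)

end MSPSA

end

/-!
The stage cost is quadratic, so the difference quotient of the two searches of a pair, paired with
the inverted perturbation, is an unbiased estimate of a multiple of its gradient. Under the
condition on `γ_i`, the `k`-th projected step therefore contracts the mean squared error of the
estimate by `1 - 1 / (N_i + k)`, up to a noise term of order `(a_{i,k} / c_{i,k})² = O(k ^ (-3/2))`.
Hence the mean squared error of `x̂_{i,k}` is of order `k ^ (-1/2)`, as is `c_{i,k}²`, and the
`k`-th pair of searches in state `i` costs `O(k ^ (-1/2))` on average; sums over at most `T` pairs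
are `O(√T)`.

The number of visits to each state is random and correlated with the noise. Summing over time is
therefore done with a potential: a function `V_{i,k}` of the current estimate which dominates the
expected cost of the `k`-th pair of searches plus the expected value of `V_{i,k+1}` at the next
estimate. Its sum over the states decreases, on average, by at least the error of each input,
whatever the state sequence is, so the total cost is at most the initial potential.
-/

/-! ### Projections and quadratic forms -/

section Projection

variable {n : ℕ} {D : Set (Vec n)}

theorem euclProj_mem_and_isLeast (hD : IsClosed D) (hne : D.Nonempty) (x : Vec n) :
    euclProj D x ∈ D ∧ ∀ z ∈ D, ‖x - euclProj D x‖ ≤ ‖x - z‖ := by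
  have hex : ∃ y ∈ D, ∀ z ∈ D, ‖x - y‖ ≤ ‖x - z‖ := by
    obtain ⟨y, hy, hdist⟩ := hD.exists_infDist_eq_dist hne x
    refine ⟨y, hy, fun z hz => ?_⟩
    rw [← dist_eq_norm, ← dist_eq_norm, ← hdist]
    exact Metric.infDist_le_dist_of_mem hz
  rw [euclProj, dif_pos hex]
  exact hex.choose_spec

theorem euclProj_mem (hD : IsClosed D) (hne : D.Nonempty) (x : Vec n) : euclProj D x ∈ D :=
  (euclProj_mem_and_isLeast hD hne x).1

theorem norm_sub_euclProj_le (hD : IsClosed D) (x : Vec n) {z : Vec n} (hz : z ∈ D) :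
    ‖x - euclProj D x‖ ≤ ‖x - z‖ :=
  (euclProj_mem_and_isLeast hD ⟨z, hz⟩ x).2 z hz

theorem euclProj_of_mem (hD : IsClosed D) {z : Vec n} (hz : z ∈ D) : euclProj D z = z := by
  have h := norm_sub_euclProj_le hD z hz
  rw [sub_self, norm_zero, norm_le_zero_iff, sub_eq_zero] at h
  exact h.symm

theorem inner_sub_euclProj_nonpos (hD : IsClosed D) (hconv : Convex ℝ D) (x : Vec n) {z : Vec n}
    (hz : z ∈ D) : inner ℝ (x - euclProj D x) (z - euclProj D x) ≤ 0 := by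
  have hmem := euclProj_mem hD ⟨z, hz⟩ x
  refine (norm_eq_iInf_iff_real_inner_le_zero hconv hmem).1 (le_antisymm ?_ ?_) z hz
  · have : Nonempty D := ⟨⟨z, hz⟩⟩
    exact le_ciInf fun y => norm_sub_euclProj_le hD x y.2
  · exact ciInf_le ⟨0, by rintro _ ⟨y, rfl⟩; positivity⟩ (⟨_, hmem⟩ : D)

theorem norm_euclProj_sub_euclProj_le (hD : IsClosed D) (hconv : Convex ℝ D) (hne : D.Nonempty)
    (x y : Vec n) : ‖euclProj D x - euclProj D y‖ ≤ ‖x - y‖ := by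
  have hx := inner_sub_euclProj_nonpos hD hconv x (euclProj_mem hD hne y)
  have hy := inner_sub_euclProj_nonpos hD hconv y (euclProj_mem hD hne x)
  set u := euclProj D x
  set v := euclProj D y
  have hsq : ‖u - v‖ * ‖u - v‖ ≤ ‖x - y‖ * ‖u - v‖ := calc
    ‖u - v‖ * ‖u - v‖ = inner ℝ (u - v) (u - v) := (real_inner_self_eq_norm_mul_norm _).symm
    _ ≤ inner ℝ (x - y) (u - v) := by
      simp only [inner_sub_left, inner_sub_right] at *
      linarith
    _ ≤ ‖x - y‖ * ‖u - v‖ := real_inner_le_norm _ _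
  rcases (norm_nonneg (u - v)).eq_or_lt with h | h
  · exact h ▸ norm_nonneg _
  · exact le_of_mul_le_mul_right hsq h

theorem continuous_euclProj (hD : IsClosed D) (hconv : Convex ℝ D) (hne : D.Nonempty) :
    Continuous (euclProj D) :=
  (LipschitzWith.of_dist_le_mul (K := 1) fun x y => by
    simpa [dist_eq_norm] using norm_euclProj_sub_euclProj_le hD hconv hne x y).continuous

theorem measurable_euclProj (hD : IsClosed D) (hconv : Convex ℝ D) : Measurable (euclProj D) := by
  rcases D.eq_empty_or_nonempty with rfl | hne
  · have hid : euclProj (∅ : Set (Vec n)) = id := funext fun x => dif_neg (by simp)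
    exact hid ▸ measurable_id
  · exact (continuous_euclProj hD hconv hne).measurable

theorem norm_euclProj_sub_le (hD : IsClosed D) (hconv : Convex ℝ D) (x : Vec n) {z : Vec n}
    (hz : z ∈ D) : ‖euclProj D x - z‖ ≤ ‖x - z‖ := by
  simpa only [euclProj_of_mem hD hz] using norm_euclProj_sub_euclProj_le hD hconv ⟨z, hz⟩ x z

end Projection

section Matrix

theorem inner_toEuclideanLin_transpose {m n : Type*} [Fintype m] [Fintype n] [DecidableEq m]
    [DecidableEq n] (S : Matrix m n ℝ) (x : EuclideanSpace ℝ n) (y : EuclideanSpace ℝ m) :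
    inner ℝ x (S.transpose.toEuclideanLin y) = inner ℝ y (S.toEuclideanLin x) := by
  rw [← Matrix.conjTranspose_eq_transpose_of_trivial,
    Matrix.toEuclideanLin_conjTranspose_eq_adjoint, LinearMap.adjoint_inner_right, real_inner_comm]

theorem toEuclideanLin_nonsing_inv_apply {n : Type*} [Fintype n] [DecidableEq n]
    {S : Matrix n n ℝ} (hS : IsUnit S) (x : EuclideanSpace ℝ n) :
    S.toEuclideanLin (S⁻¹.toEuclideanLin x) = x := by
  rw [Matrix.toLpLin_apply, Matrix.toLpLin_apply, Matrix.mulVec_mulVec,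
    Matrix.mul_nonsing_inv _ ((Matrix.isUnit_iff_isUnit_det S).1 hS), Matrix.one_mulVec]

theorem posSemidef_sub_algebraMap {n : Type*} [Fintype n] [DecidableEq n] {S : Matrix n n ℝ}
    (hS : S.IsHermitian) {l : ℝ} (hl : ∀ a ∈ spectrum ℝ S, l ≤ a) :
    (S - algebraMap ℝ _ l).PosSemidef := by
  refine Matrix.posSemidef_iff_isHermitian_and_spectrum_nonneg.2 ⟨hS.sub ?_, ?_⟩
  · rw [Matrix.IsHermitian, Matrix.algebraMap_eq_diagonal, Matrix.diagonal_conjTranspose]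
    rfl
  · rw [← spectrum.sub_singleton_eq]
    rintro _ ⟨a, ha, _, rfl, rfl⟩
    exact sub_nonneg.2 (hl a ha)

theorem mul_norm_sq_le_inner_toEuclideanLin {n : Type*} [Fintype n] [DecidableEq n]
    {S : Matrix n n ℝ} (hS : S.IsHermitian) {l : ℝ} (hl : ∀ a ∈ spectrum ℝ S, l ≤ a)
    (x : EuclideanSpace ℝ n) : l * ‖x‖ ^ 2 ≤ inner ℝ x (S.toEuclideanLin x) := by
  have h := (posSemidef_sub_algebraMap hS hl).dotProduct_mulVec_nonneg x.ofLp
  have hsub : (S - algebraMap ℝ _ l).toEuclideanLin x = S.toEuclideanLin x - l • x := by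
    ext i
    simp [Matrix.toLpLin_apply, Algebra.algebraMap_eq_smul_one]
  rw [star_trivial, ← Matrix.inner_toEuclideanCLM] at h
  change 0 ≤ inner ℝ x ((S - algebraMap ℝ _ l).toEuclideanLin x) at h
  rw [hsub, inner_sub_right, real_inner_smul_right, real_inner_self_eq_norm_sq] at h
  linarith

variable {n : ℕ} {S : Matrix (Fin n) (Fin n) ℝ}

theorem minEigenvalue_mul_norm_sq_le (hS : S.IsHermitian) (x : Vec n) :
    minEigenvalue S * ‖x‖ ^ 2 ≤ inner ℝ x (S.toEuclideanLin x) := by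
  have hbdd : BddBelow (spectrum ℝ S) := Matrix.finite_real_spectrum.bddBelow
  exact mul_norm_sq_le_inner_toEuclideanLin hS (fun _ ha => csInf_le hbdd ha) x

theorem minEigenvalue_pos [NeZero n] (hS : S.PosDef) : 0 < minEigenvalue S := by
  have hspec := hS.1.spectrum_real_eq_range_eigenvalues
  have hmem : minEigenvalue S ∈ spectrum ℝ S :=
    (hspec ▸ Set.range_nonempty _).csInf_mem Matrix.finite_real_spectrum
  obtain ⟨i, hi⟩ := hspec ▸ hmem
  exact hi ▸ hS.eigenvalues_pos i

end Matrix

/-! ### The stage cost -/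

theorem measurable_apply_of_countable {ι α β : Type*} [Countable ι] [MeasurableSpace ι]
    [MeasurableSingletonClass ι] [MeasurableSpace α] [MeasurableSpace β] {F : ι → α → β}
    (hF : ∀ j, Measurable (F j)) {i : α → ι} (hi : Measurable i) :
    Measurable fun a => F (i a) a := by
  simpa only [Function.comp_def, id] using
    (measurable_from_prod_countable_right (f := fun q : ι × α => F q.1 q.2) hF).comp
      (hi.prodMk measurable_id)

namespace Model

section Hessian

variable {K n : ℕ} (I : Model K n)

/-- The Hessian `-∑_j p_{i,j} (A_j + A_jᵀ)` of the quadratic function `I.stageCost i`. -/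
noncomputable def hess (i : Fin K) : Matrix (Fin n) (Fin n) ℝ :=
  -∑ j, I.P i j • (I.A j + (I.A j).transpose)

/-- The linear coefficient `∑_j p_{i,j} b_j` of `I.stageCost i`, up to sign. -/
noncomputable def meanIntercept (i : Fin K) : Vec n := ∑ j, I.P i j • I.b j

theorem inner_hess (i : Fin K) (x y : Vec n) :
    inner ℝ x ((I.hess i).toEuclideanLin y) =
      -∑ j, I.P i j * (inner ℝ x ((I.A j).toEuclideanLin y) +
        inner ℝ y ((I.A j).toEuclideanLin x)) := by
  simp only [hess, map_neg, map_sum, map_smul, map_add, LinearMap.neg_apply, LinearMap.sum_apply,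
    LinearMap.smul_apply, LinearMap.add_apply, inner_neg_right, inner_sum, inner_smul_right,
    inner_add_right, inner_toEuclideanLin_transpose]

theorem inner_hess_comm (i : Fin K) (x y : Vec n) :
    inner ℝ x ((I.hess i).toEuclideanLin y) = inner ℝ y ((I.hess i).toEuclideanLin x) := by
  simp only [inner_hess, add_comm]

theorem isHermitian_hess (i : Fin K) : (I.hess i).IsHermitian := by
  rw [Matrix.IsHermitian, Matrix.conjTranspose_eq_transpose_of_trivial]
  simp only [hess, Matrix.transpose_neg, Matrix.transpose_sum, Matrix.transpose_smul,
    Matrix.transpose_add, Matrix.transpose_transpose, add_comm]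

variable {I} {Θ : Set (Params K n)} {D : Set (Vec n)} {σw : ℝ}

theorem Admissible.P_nonneg (h : I.Admissible Θ D σw) (i j : Fin K) : 0 ≤ I.P i j :=
  h.stochastic.1 i j

theorem Admissible.P_sum (h : I.Admissible Θ D σw) (i : Fin K) : ∑ j, I.P i j = 1 :=
  (Matrix.mem_rowStochastic_iff_sum.1 h.stochastic).2 i

theorem Admissible.exists_P_pos (h : I.Admissible Θ D σw) (i : Fin K) : ∃ j, 0 < I.P i j := by
  by_contra! hle
  linarith [h.P_sum i, Finset.sum_nonpos fun j (_ : j ∈ Finset.univ) => hle j]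

theorem Admissible.inner_hess_self_pos (h : I.Admissible Θ D σw) (i : Fin K) {x : Vec n}
    (hx : x ≠ 0) : 0 < inner ℝ x ((I.hess i).toEuclideanLin x) := by
  obtain ⟨j, hj⟩ := h.exists_P_pos i
  have hneg : ∀ k, inner ℝ x ((I.A k).toEuclideanLin x) < 0 := fun k => h.negDef k x hx
  rw [inner_hess, neg_pos]
  refine Finset.sum_neg' (fun k _ => ?_) ⟨j, Finset.mem_univ _, ?_⟩
  · exact mul_nonpos_of_nonneg_of_nonpos (h.P_nonneg i k) (by linarith [hneg k])
  · exact mul_neg_of_pos_of_neg hj (by linarith [hneg j])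

theorem Admissible.posDef_hess (h : I.Admissible Θ D σw) (i : Fin K) : (I.hess i).PosDef := by
  refine Matrix.PosDef.of_dotProduct_mulVec_pos (I.isHermitian_hess i) fun x hx => ?_
  have hpos := h.inner_hess_self_pos i (x := WithLp.toLp 2 x) (by simpa using hx)
  rw [star_trivial]
  exact (Matrix.inner_toEuclideanCLM (I.hess i) _ _).symm ▸ hpos

theorem Admissible.hess_optInput (h : I.Admissible Θ D σw) (i : Fin K) :
    (I.hess i).toEuclideanLin (I.optInput i) = I.meanIntercept i := by
  have hunit : IsUnit (∑ j, I.P i j • (I.A j + (I.A j).transpose)) := by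
    simpa only [hess, IsUnit.neg_iff] using (h.posDef_hess i).isUnit
  rw [hess, optInput, map_neg, map_neg, LinearMap.neg_apply, neg_neg]
  exact toEuclideanLin_nonsing_inv_apply hunit _

theorem Admissible.norm_sq_le_inner_hess (h : I.Admissible Θ D σw) {p : MSPSA K n}
    (hγ : ∀ i, 0 < p.γ i) (hstep : p.StepCondition I) (i : Fin K) (x : Vec n) :
    ‖x‖ ^ 2 ≤ 4 * p.γ i * inner ℝ x ((I.hess i).toEuclideanLin x) := by
  rcases Nat.eq_zero_or_pos n with rfl | hn
  · simp [Subsingleton.elim x 0]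
  have : NeZero n := ⟨hn.ne'⟩
  set l := minEigenvalue ((1 / 2 : ℝ) • I.hess i) with hl
  have hstep' : 1 / (8 * l) ≤ p.γ i := by
    simpa only [hl, hess, smul_neg, Finset.smul_sum, smul_comm (1 / 2 : ℝ)] using hstep i
  have hpd : ((1 / 2 : ℝ) • I.hess i).PosDef := (h.posDef_hess i).smul (by norm_num)
  have hl_pos : 0 < l := minEigenvalue_pos hpd
  have hle : l * ‖x‖ ^ 2 ≤ 1 / 2 * inner ℝ x ((I.hess i).toEuclideanLin x) := by
    simpa only [map_smul, LinearMap.smul_apply, inner_smul_right]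
      using minEigenvalue_mul_norm_sq_le hpd.1 x
  rw [div_le_iff₀ (by positivity)] at hstep'
  calc ‖x‖ ^ 2 ≤ p.γ i * (8 * l) * ‖x‖ ^ 2 := le_mul_of_one_le_left (sq_nonneg _) hstep'
    _ = 8 * p.γ i * (l * ‖x‖ ^ 2) := by ring
    _ ≤ 8 * p.γ i * (1 / 2 * inner ℝ x ((I.hess i).toEuclideanLin x)) := by
      have := hγ i
      gcongr
    _ = 4 * p.γ i * inner ℝ x ((I.hess i).toEuclideanLin x) := by ring

end Hessian

section NextLaw

variable {K n : ℕ} (I : Model K n)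

/-- The joint law of the next state and of the noise in that state, given the current state `i`. -/
noncomputable def nextLaw (i : Fin K) : Measure (Fin K × Vec n) :=
  ∑ j, ENNReal.ofReal (I.P i j) • (I.f j).map (Prod.mk j)

theorem nextLaw_apply (i : Fin K) {V : Set (Fin K × Vec n)} (hV : MeasurableSet V) :
    I.nextLaw i V = ∑ j, ENNReal.ofReal (I.P i j) * I.f j (Prod.mk j ⁻¹' V) := by
  simp only [nextLaw, Measure.coe_finsetSum, Finset.sum_apply, Measure.smul_apply, smul_eq_mul,
    Measure.map_apply measurable_prodMk_left hV]

theorem measurableEmbedding_prodMk {α β : Type*} [MeasurableSpace α] [MeasurableSingletonClass α]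
    [MeasurableSpace β] (a : α) : MeasurableEmbedding (Prod.mk a : β → α × β) :=
  MeasurableEmbedding.prodMk_left a MeasurableEmbedding.id

variable {I} {F : Fin K × Vec n → ℝ}

theorem integrable_smul_map_prodMk {i j : Fin K}
    (hF : Integrable (fun w => F (j, w)) (I.f j)) :
    Integrable F (ENNReal.ofReal (I.P i j) • (I.f j).map (Prod.mk j)) :=
  ((measurableEmbedding_prodMk j).integrable_map_iff.2 hF).smul_measure ENNReal.ofReal_ne_top

theorem integrable_nextLaw (i : Fin K)
    (hF : ∀ j, Integrable (fun w => F (j, w)) (I.f j)) : Integrable F (I.nextLaw i) :=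
  integrable_finsetSum_measure.2 fun j _ => integrable_smul_map_prodMk (hF j)

variable {Θ : Set (Params K n)} {D : Set (Vec n)} {σw : ℝ}

theorem Admissible.integral_nextLaw (h : I.Admissible Θ D σw) (i : Fin K)
    (hF : ∀ j, Integrable (fun w => F (j, w)) (I.f j)) :
    ∫ z, F z ∂(I.nextLaw i) = ∑ j, I.P i j * ∫ w, F (j, w) ∂(I.f j) := by
  rw [nextLaw, integral_finsetSum_measure fun j _ => integrable_smul_map_prodMk (hF j)]
  refine Finset.sum_congr rfl fun j _ => ?_
  rw [integral_smul_measure, (measurableEmbedding_prodMk j).integral_map,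
    ENNReal.toReal_ofReal (h.P_nonneg i j), smul_eq_mul]

theorem Admissible.isProbabilityMeasure_nextLaw (h : I.Admissible Θ D σw) (i : Fin K) :
    IsProbabilityMeasure (I.nextLaw i) := by
  have hf : ∀ j, I.f j Set.univ = 1 := fun j => (h.noise_prob j).measure_univ
  constructor
  rw [I.nextLaw_apply i MeasurableSet.univ]
  simp only [Set.preimage_univ, hf, mul_one]
  rw [← ENNReal.ofReal_sum_of_nonneg fun j _ => h.P_nonneg i j, h.P_sum, ENNReal.ofReal_one]

end NextLaw

section Noise

variable {K n : ℕ} {I : Model K n} {Θ : Set (Params K n)} {D : Set (Vec n)} {σw : ℝ}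

theorem Admissible.memLp_noise (h : I.Admissible Θ D σw) (k : Fin K) :
    MemLp (fun w : Vec n => w) 2 (I.f k) :=
  have := h.noise_prob k
  MemLp.of_eval_piLp fun l => h.noise_memLp k l

theorem Admissible.integral_noise (h : I.Admissible Θ D σw) (k : Fin K) :
    ∫ w, w ∂(I.f k) = 0 := by
  have := h.noise_prob k
  ext l
  rw [eval_integral_piLp fun l => (h.noise_memLp k l).integrable one_le_two]
  exact h.noise_mean k l

theorem Admissible.integral_inner_noise (h : I.Admissible Θ D σw) (k : Fin K) (x : Vec n) :
    ∫ w, inner ℝ x w ∂(I.f k) = 0 := by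
  have := h.noise_prob k
  rw [integral_inner ((h.memLp_noise k).integrable one_le_two), h.integral_noise, inner_zero_right]

theorem Admissible.integrable_norm_sq_noise (h : I.Admissible Θ D σw) (k : Fin K) :
    Integrable (fun w => ‖w‖ ^ 2) (I.f k) :=
  (h.memLp_noise k).norm.integrable_sq

theorem Admissible.integral_norm_sq_noise_le (h : I.Admissible Θ D σw) (k : Fin K) :
    ∫ w, ‖w‖ ^ 2 ∂(I.f k) ≤ n * σw ^ 2 := calc
  ∫ w, ‖w‖ ^ 2 ∂(I.f k) = ∑ l, ∫ w, w l ^ 2 ∂(I.f k) := by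
    simp only [EuclideanSpace.real_norm_sq_eq]
    exact integral_finsetSum _ fun l _ => (h.noise_memLp k l).integrable_sq
  _ ≤ ∑ _l : Fin n, σw ^ 2 := Finset.sum_le_sum fun l _ => h.noise_var k l
  _ = n * σw ^ 2 := by simp

theorem Admissible.integral_norm_sq_nextLaw_le (h : I.Admissible Θ D σw) (i : Fin K) :
    ∫ z, ‖z.2‖ ^ 2 ∂(I.nextLaw i) ≤ n * σw ^ 2 := by
  rw [h.integral_nextLaw i fun j => h.integrable_norm_sq_noise j]
  refine (Finset.sum_le_sum fun j _ => mul_le_mul_of_nonneg_left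
    (h.integral_norm_sq_noise_le j) (h.P_nonneg i j)).trans_eq ?_
  rw [← Finset.sum_mul, h.P_sum, one_mul]

end Noise

section ObservedCost

variable {K n : ℕ} (I : Model K n)

/-- The observed cost `-x ⬝ y` for input `x` when the next state and the noise are `z`. -/
noncomputable def obsCost (x : Vec n) (z : Fin K × Vec n) : ℝ := -inner ℝ x (I.output z.1 x z.2)

theorem obsCost_mk (x : Vec n) (j : Fin K) (w : Vec n) :
    I.obsCost x (j, w) =
      -(inner ℝ x ((I.A j).toEuclideanLin x) + inner ℝ x (I.b j)) - inner ℝ x w := by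
  simp only [obsCost, output, inner_add_right]
  ring

theorem continuous_toEuclideanLin_A (j : Fin K) : Continuous (I.A j).toEuclideanLin :=
  LinearMap.continuous_of_finiteDimensional _

variable {α : Type*} [MeasurableSpace α] {x : α → Vec n}

theorem measurable_output {j : α → Fin K} {w : α → Vec n} (hj : Measurable j)
    (hx : Measurable x) (hw : Measurable w) :
    Measurable fun a => I.output (j a) (x a) (w a) := by
  refine measurable_apply_of_countable (F := fun j a => I.output j (x a) (w a)) (fun j => ?_) hj
  have hA := (I.continuous_toEuclideanLin_A j).measurable
  unfold output
  fun_prop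

@[fun_prop]
theorem measurable_obsCost {z : α → Fin K × Vec n} (hx : Measurable x) (hz : Measurable z) :
    Measurable fun a => I.obsCost (x a) (z a) :=
  (hx.inner (I.measurable_output hz.fst hx hz.snd)).neg

variable {I} {Θ : Set (Params K n)} {D : Set (Vec n)} {σw : ℝ}

theorem Admissible.memLp_obsCost_mk (h : I.Admissible Θ D σw) (x : Vec n) (j : Fin K) :
    MemLp (fun w => I.obsCost x (j, w)) 2 (I.f j) := by
  have := h.noise_prob j
  simp only [obsCost_mk]
  exact (memLp_const _).sub ((h.memLp_noise j).const_inner x)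

theorem Admissible.memLp_obsCost (h : I.Admissible Θ D σw) (x : Vec n) (i : Fin K) :
    MemLp (I.obsCost x) 2 (I.nextLaw i) := by
  have hmeas : Measurable (I.obsCost x) := I.measurable_obsCost measurable_const measurable_id
  exact (memLp_two_iff_integrable_sq hmeas.aestronglyMeasurable).2
    (integrable_nextLaw i fun j => (h.memLp_obsCost_mk x j).integrable_sq)

theorem Admissible.integral_obsCost_mk (h : I.Admissible Θ D σw) (x : Vec n) (j : Fin K) :
    ∫ w, I.obsCost x (j, w) ∂(I.f j) =
      -(inner ℝ x ((I.A j).toEuclideanLin x) + inner ℝ x (I.b j)) := by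
  have := h.noise_prob j
  simp only [obsCost_mk]
  rw [integral_sub (integrable_const _)
    (((h.memLp_noise j).const_inner x).integrable one_le_two), h.integral_inner_noise]
  simp

theorem Admissible.integral_obsCost (h : I.Admissible Θ D σw) (x : Vec n) (i : Fin K) :
    ∫ z, I.obsCost x z ∂(I.nextLaw i) = I.stageCost i x :=
  h.integral_nextLaw i fun j =>
    have := h.noise_prob j
    (h.memLp_obsCost_mk x j).integrable one_le_two

theorem Admissible.stageCost_eq (h : I.Admissible Θ D σw) (i : Fin K) (x : Vec n) :
    I.stageCost i x =
      1 / 2 * inner ℝ x ((I.hess i).toEuclideanLin x) - inner ℝ x (I.meanIntercept i) := by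
  have hmean : I.stageCost i x = ∑ j, I.P i j * ∫ w, I.obsCost x (j, w) ∂(I.f j) := rfl
  rw [hmean, inner_hess, meanIntercept, inner_sum, mul_neg, Finset.mul_sum,
    ← Finset.sum_neg_distrib, ← Finset.sum_sub_distrib]
  refine Finset.sum_congr rfl fun j _ => ?_
  rw [h.integral_obsCost_mk, inner_smul_right]
  ring

theorem Admissible.stageCost_sub_stageCost_optInput (h : I.Admissible Θ D σw) (i : Fin K)
    (x : Vec n) :
    I.stageCost i x - I.stageCost i (I.optInput i) =
      1 / 2 * inner ℝ (x - I.optInput i) ((I.hess i).toEuclideanLin (x - I.optInput i)) := by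
  rw [h.stageCost_eq, h.stageCost_eq, ← h.hess_optInput]
  simp only [map_sub, inner_sub_left, inner_sub_right]
  rw [I.inner_hess_comm i (I.optInput i) x]
  ring

theorem Admissible.stageCost_add_sub_stageCost_sub (h : I.Admissible Θ D σw) (i : Fin K)
    (x v : Vec n) :
    I.stageCost i (x + v) - I.stageCost i (x - v) =
      2 * inner ℝ v ((I.hess i).toEuclideanLin (x - I.optInput i)) := by
  rw [h.stageCost_eq, h.stageCost_eq, ← h.hess_optInput]
  simp only [map_sub, map_add, inner_sub_left, inner_sub_right, inner_add_left, inner_add_right]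
  rw [I.inner_hess_comm i x v]
  ring

theorem Admissible.stageCost_optInput_le (h : I.Admissible Θ D σw) (i : Fin K) (x : Vec n) :
    I.stageCost i (I.optInput i) ≤ I.stageCost i x := by
  rw [← sub_nonneg, h.stageCost_sub_stageCost_optInput]
  rcases eq_or_ne (x - I.optInput i) 0 with he | he
  · simp [he]
  · exact mul_nonneg one_half_pos.le (h.inner_hess_self_pos i he).le

theorem Admissible.measurable_stageCost (h : I.Admissible Θ D σw) (i : Fin K) :
    Measurable (I.stageCost i) := by
  have hH : Measurable (I.hess i).toEuclideanLin :=
    (LinearMap.continuous_of_finiteDimensional _).measurable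
  rw [funext (h.stageCost_eq i)]
  fun_prop

end ObservedCost

section NormBound

variable {K n : ℕ}

/-- `M` bounds the operator norms of all `A_k` and the norms of all `b_k`. -/
structure NormBound (I : Model K n) (M : ℝ) : Prop where
  norm_A_le : ∀ k x, ‖(I.A k).toEuclideanLin x‖ ≤ M * ‖x‖
  norm_b_le : ∀ k, ‖I.b k‖ ≤ M

theorem exists_normBound {Θ : Set (Params K n)} (hΘ : IsCompact Θ) :
    ∃ M, 0 ≤ M ∧ ∀ I : Model K n, I.θ ∈ Θ → I.NormBound M := by
  let toCLM (θ : Params K n) (k : Fin K) : (Vec n →L[ℝ] Vec n) × Vec n :=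
    (Matrix.toEuclideanCLM (n := Fin n) (𝕜 := ℝ) (θ k).1, (θ k).2)
  have hcont : Continuous toCLM := by
    have hA : Continuous (Matrix.toEuclideanCLM (n := Fin n) (𝕜 := ℝ)) :=
      LinearMap.continuous_of_finiteDimensional
        (Matrix.toEuclideanCLM (n := Fin n) (𝕜 := ℝ)).toAlgEquiv.toLinearMap
    fun_prop
  obtain ⟨M, hM⟩ := hΘ.exists_bound_of_continuousOn hcont.continuousOn
  refine ⟨max M 0, le_max_right _ _, fun I hI => ?_⟩
  have hle : ∀ k, ‖toCLM I.θ k‖ ≤ max M 0 := fun k =>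
    (norm_le_pi_norm _ k).trans ((hM _ hI).trans (le_max_left _ _))
  exact ⟨fun k => (toCLM I.θ k).1.le_of_opNorm_le ((norm_fst_le _).trans (hle k)),
    fun k => (norm_snd_le (toCLM I.θ k)).trans (hle k)⟩

variable {I : Model K n} {Θ : Set (Params K n)} {D : Set (Vec n)} {σw M r : ℝ}

theorem NormBound.nonneg (hM : I.NormBound M) (k : Fin K) : 0 ≤ M :=
  (norm_nonneg _).trans (hM.norm_b_le k)

theorem NormBound.norm_output_le (hM : I.NormBound M) {x : Vec n} (hx : ‖x‖ ≤ r) (k : Fin K)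
    (w : Vec n) : ‖I.output k x w‖ ≤ M * r + M + ‖w‖ := calc
  ‖I.output k x w‖ ≤ ‖(I.A k).toEuclideanLin x‖ + ‖I.b k‖ + ‖w‖ := norm_add₃_le
  _ ≤ M * r + M + ‖w‖ := by
    have := hM.nonneg k
    have hA : ‖(I.A k).toEuclideanLin x‖ ≤ M * r := (hM.norm_A_le k x).trans (by gcongr)
    gcongr
    exact hM.norm_b_le k

theorem NormBound.sq_obsCost_le (hM : I.NormBound M) {x : Vec n} (hx : ‖x‖ ≤ r)
    (z : Fin K × Vec n) :
    I.obsCost x z ^ 2 ≤ 2 * r ^ 2 * ((M * r + M) ^ 2 + ‖z.2‖ ^ 2) := by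
  have habs : |I.obsCost x z| ≤ r * (M * r + M + ‖z.2‖) := by
    rw [obsCost, abs_neg]
    exact (abs_real_inner_le_norm _ _).trans <|
      mul_le_mul hx (hM.norm_output_le hx z.1 z.2) (norm_nonneg _) ((norm_nonneg x).trans hx)
  calc I.obsCost x z ^ 2 = |I.obsCost x z| ^ 2 := (sq_abs _).symm
    _ ≤ (r * (M * r + M + ‖z.2‖)) ^ 2 := by gcongr
    _ = r ^ 2 * (M * r + M + ‖z.2‖) ^ 2 := mul_pow _ _ _
    _ ≤ r ^ 2 * (2 * ((M * r + M) ^ 2 + ‖z.2‖ ^ 2)) := by gcongr; exact add_sq_le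
    _ = 2 * r ^ 2 * ((M * r + M) ^ 2 + ‖z.2‖ ^ 2) := by ring

theorem Admissible.integral_sq_obsCost_le (h : I.Admissible Θ D σw) (hM : I.NormBound M)
    {x : Vec n} (hx : ‖x‖ ≤ r) (i : Fin K) :
    ∫ z, I.obsCost x z ^ 2 ∂(I.nextLaw i) ≤ 2 * r ^ 2 * ((M * r + M) ^ 2 + n * σw ^ 2) := by
  have := h.isProbabilityMeasure_nextLaw i
  have hnoise : Integrable (fun z : Fin K × Vec n => ‖z.2‖ ^ 2) (I.nextLaw i) :=
    integrable_nextLaw i fun j => h.integrable_norm_sq_noise j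
  have hbound : Integrable (fun z : Fin K × Vec n => (M * r + M) ^ 2 + ‖z.2‖ ^ 2) (I.nextLaw i) :=
    (integrable_const _).add hnoise
  calc ∫ z, I.obsCost x z ^ 2 ∂(I.nextLaw i)
      ≤ ∫ z, 2 * r ^ 2 * ((M * r + M) ^ 2 + ‖z.2‖ ^ 2) ∂(I.nextLaw i) :=
        integral_mono (h.memLp_obsCost x i).integrable_sq (hbound.const_mul _) (hM.sq_obsCost_le hx)
    _ = 2 * r ^ 2 * ((M * r + M) ^ 2 + ∫ z, ‖z.2‖ ^ 2 ∂(I.nextLaw i)) := by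
        rw [integral_const_mul, integral_add (integrable_const _) hnoise, integral_const,
          probReal_univ, one_smul]
    _ ≤ 2 * r ^ 2 * ((M * r + M) ^ 2 + n * σw ^ 2) := by
        gcongr
        exact h.integral_norm_sq_nextLaw_le i

theorem Admissible.stageCost_sub_stageCost_optInput_le (h : I.Admissible Θ D σw)
    (hM : I.NormBound M) (i : Fin K) (x : Vec n) :
    I.stageCost i x - I.stageCost i (I.optInput i) ≤ M * ‖x - I.optInput i‖ ^ 2 := by
  rw [h.stageCost_sub_stageCost_optInput, inner_hess]
  set e := x - I.optInput i
  have hA : ∀ j, -inner ℝ e ((I.A j).toEuclideanLin e) ≤ M * ‖e‖ ^ 2 := fun j => calc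
    -inner ℝ e ((I.A j).toEuclideanLin e) ≤ ‖e‖ * ‖(I.A j).toEuclideanLin e‖ :=
      (neg_le_abs _).trans (abs_real_inner_le_norm _ _)
    _ ≤ ‖e‖ * (M * ‖e‖) := by gcongr; exact hM.norm_A_le j e
    _ = M * ‖e‖ ^ 2 := by ring
  calc 1 / 2 * -∑ j, I.P i j *
        (inner ℝ e ((I.A j).toEuclideanLin e) + inner ℝ e ((I.A j).toEuclideanLin e))
      = ∑ j, I.P i j * -inner ℝ e ((I.A j).toEuclideanLin e) := by
        rw [← Finset.sum_neg_distrib, Finset.mul_sum]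
        exact Finset.sum_congr rfl fun j _ => by ring
    _ ≤ ∑ j, I.P i j * (M * ‖e‖ ^ 2) :=
        Finset.sum_le_sum fun j _ => mul_le_mul_of_nonneg_left (hA j) (h.P_nonneg i j)
    _ = M * ‖e‖ ^ 2 := by rw [← Finset.sum_mul, h.P_sum, one_mul]

end NormBound

end Model

/-! ### Simultaneous perturbations -/

namespace MSPSA

section PerturbationLaw

variable {K n : ℕ} {p : MSPSA K n} {D : Set (Vec n)} {ξ₁ ξ₂ : ℝ}

theorem Valid.ae_ne_zero (hp : p.Valid D ξ₁ ξ₂) : ∀ᵐ x ∂p.ν, x ≠ 0 := by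
  have hfin : ∀ᵐ x ∂p.ν, (ENNReal.ofReal (x ^ 2))⁻¹ < ∞ :=
    ae_lt_top (by fun_prop) (ne_top_of_le_ne_top ENNReal.ofReal_ne_top hp.ν_inv)
  filter_upwards [hfin] with x hx h0
  simp [h0] at hx

theorem Valid.lintegral_inv_sq_le (hp : p.Valid D ξ₁ ξ₂) :
    ∫⁻ x, ENNReal.ofReal ((1 / x) ^ 2) ∂p.ν ≤ ENNReal.ofReal ξ₂ := by
  refine (lintegral_mono_ae ?_).trans hp.ν_inv
  filter_upwards [hp.ae_ne_zero] with x hx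
  rw [one_div, inv_pow, ENNReal.ofReal_inv_of_pos (by positivity)]

theorem Valid.memLp_inv (hp : p.Valid D ξ₁ ξ₂) : MemLp (fun x : ℝ => 1 / x) 2 p.ν := by
  have hmeas : Measurable fun x : ℝ => 1 / x := by fun_prop
  rw [memLp_two_iff_integrable_sq hmeas.aestronglyMeasurable]
  refine ⟨(hmeas.pow_const 2).aestronglyMeasurable, ?_⟩
  rw [hasFiniteIntegral_iff_ofReal (ae_of_all _ fun x => sq_nonneg _)]
  exact hp.lintegral_inv_sq_le.trans_lt ENNReal.ofReal_lt_top

theorem Valid.integral_inv_sq_le (hp : p.Valid D ξ₁ ξ₂) (hξ₂ : 0 ≤ ξ₂) :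
    ∫ x, (1 / x) ^ 2 ∂p.ν ≤ ξ₂ := by
  rw [integral_eq_lintegral_of_nonneg_ae (ae_of_all _ fun x => sq_nonneg _)
    hp.memLp_inv.integrable_sq.aestronglyMeasurable]
  exact ENNReal.toReal_le_of_le_ofReal hξ₂ hp.lintegral_inv_sq_le

theorem Valid.integral_id (hp : p.Valid D ξ₁ ξ₂) : ∫ x, x ∂p.ν = 0 := by
  have hsymm : ∫ x, x ∂p.ν = -∫ x, x ∂p.ν := calc
    ∫ x, x ∂p.ν = ∫ x, x ∂(p.ν.map fun x => -x) := by rw [hp.ν_symm]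
    _ = ∫ x, -x ∂p.ν := integral_map (by fun_prop) (by fun_prop)
    _ = -∫ x, x ∂p.ν := integral_neg _
  linarith

/-- The law on `ℝⁿ` of a single perturbation vector, whose entries are i.i.d. with law `ν`. -/
noncomputable def pertLaw (p : MSPSA K n) : Measure (Vec n) :=
  (Measure.pi fun _ : Fin n => p.ν).map (WithLp.toLp 2)

theorem measurePreserving_toLp_pertLaw (p : MSPSA K n) :
    MeasurePreserving (WithLp.toLp 2) (Measure.pi fun _ : Fin n => p.ν) p.pertLaw :=
  ⟨by fun_prop, rfl⟩

theorem Valid.isProbabilityMeasure_pertLaw (hp : p.Valid D ξ₁ ξ₂) :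
    IsProbabilityMeasure p.pertLaw :=
  have := hp.ν_prob
  Measure.isProbabilityMeasure_map (by fun_prop)

theorem Valid.measurePreserving_apply_pertLaw (hp : p.Valid D ξ₁ ξ₂) (l : Fin n) :
    MeasurePreserving (fun v : Vec n => v l) p.pertLaw p.ν := by
  have := hp.ν_prob
  refine ⟨by fun_prop, ?_⟩
  rw [pertLaw, Measure.map_map (by fun_prop) (by fun_prop)]
  exact (measurePreserving_eval (fun _ : Fin n => p.ν) l).map_eq

theorem Valid.indepFun_apply_pertLaw (hp : p.Valid D ξ₁ ξ₂) {l m : Fin n} (hlm : l ≠ m) :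
    IndepFun (fun v : Vec n => v l) (fun v : Vec n => v m) p.pertLaw := by
  have := hp.ν_prob
  have hpi : IndepFun (fun v : Fin n → ℝ => v l) (fun v => v m) (Measure.pi fun _ => p.ν) :=
    (iIndepFun_pi (X := fun _ x => x) fun _ => aemeasurable_id).indepFun hlm
  have hmp := p.measurePreserving_toLp_pertLaw (n := n)
  rw [indepFun_iff_measure_inter_preimage_eq_mul] at hpi ⊢
  intro s t hs ht
  have hls : MeasurableSet ((fun v : Vec n => v l) ⁻¹' s) := hs.preimage (by fun_prop)
  have hmt : MeasurableSet ((fun v : Vec n => v m) ⁻¹' t) := ht.preimage (by fun_prop)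
  rw [← hmp.measure_preimage (hls.inter hmt).nullMeasurableSet,
    ← hmp.measure_preimage hls.nullMeasurableSet, ← hmp.measure_preimage hmt.nullMeasurableSet]
  exact hpi s t hs ht

theorem Valid.ae_pertLaw (hp : p.Valid D ξ₁ ξ₂) {P : ℝ → Prop} (h : ∀ᵐ x ∂p.ν, P x) :
    ∀ᵐ v ∂p.pertLaw, ∀ l, P (v l) :=
  ae_all_iff.2 fun l => (hp.measurePreserving_apply_pertLaw l).quasiMeasurePreserving.ae h

theorem Valid.integrable_inv_mul (hp : p.Valid D ξ₁ ξ₂) (l m : Fin n) :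
    Integrable (fun v : Vec n => 1 / v l * v m) p.pertLaw := by
  have := hp.ν_prob
  have hinv : Integrable (fun v : Vec n => 1 / v l) p.pertLaw :=
    (hp.measurePreserving_apply_pertLaw l).integrable_comp_of_integrable
      (hp.memLp_inv.integrable one_le_two)
  refine hinv.mul_bdd (c := ξ₁) (by fun_prop) ?_
  filter_upwards [hp.ae_pertLaw hp.ν_bdd] with v hv using hv m

theorem Valid.integral_inv_mul_self (hp : p.Valid D ξ₁ ξ₂) (l : Fin n) :
    ∫ v : Vec n, 1 / v l * v l ∂p.pertLaw = 1 := by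
  have := hp.isProbabilityMeasure_pertLaw
  have hone : (fun v : Vec n => 1 / v l * v l) =ᵐ[p.pertLaw] fun _ => 1 := by
    filter_upwards [hp.ae_pertLaw hp.ae_ne_zero] with v hv
    exact one_div_mul_cancel (hv l)
  rw [integral_congr_ae hone, integral_const, probReal_univ, one_smul]

theorem Valid.integral_inv_mul_of_ne (hp : p.Valid D ξ₁ ξ₂) {l m : Fin n} (hlm : l ≠ m) :
    ∫ v : Vec n, 1 / v l * v m ∂p.pertLaw = 0 := by
  have hmean : ∫ v : Vec n, v m ∂p.pertLaw = 0 := by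
    have hmp := hp.measurePreserving_apply_pertLaw m
    rw [← hp.integral_id, ← hmp.map_eq, integral_map (by fun_prop) (by fun_prop)]
  have hind : IndepFun (fun v : Vec n => 1 / v l) (fun v : Vec n => v m) p.pertLaw :=
    (hp.indepFun_apply_pertLaw hlm).comp (φ := fun x => 1 / x) (by fun_prop) measurable_id
  rw [hind.integral_fun_mul_eq_mul_integral (Measurable.aestronglyMeasurable (by fun_prop))
    (by fun_prop), hmean, mul_zero]

/-- The entrywise inverse of a vector, with the convention `1 / 0 = 0`. -/
noncomputable def invVec (v : Vec n) : Vec n := WithLp.toLp 2 fun l => 1 / v l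

theorem inner_invVec_mul_inner (e g v : Vec n) :
    inner ℝ e (invVec v) * inner ℝ v g = ∑ l, ∑ m, e l * g m * (1 / v l * v m) := by
  simp only [PiLp.inner_apply, invVec, Finset.sum_mul_sum, RCLike.inner_apply, conj_trivial]
  refine Finset.sum_congr rfl fun l _ => Finset.sum_congr rfl fun m _ => by ring

theorem Valid.integrable_inner_invVec_mul_inner (hp : p.Valid D ξ₁ ξ₂) (e g : Vec n) :
    Integrable (fun v => inner ℝ e (invVec v) * inner ℝ v g) p.pertLaw := by
  simp only [inner_invVec_mul_inner]
  exact integrable_finsetSum _ fun l _ => integrable_finsetSum _ fun m _ =>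
    (hp.integrable_inv_mul l m).const_mul _

theorem Valid.integral_inner_invVec_mul_inner (hp : p.Valid D ξ₁ ξ₂) (e g : Vec n) :
    ∫ v, inner ℝ e (invVec v) * inner ℝ v g ∂p.pertLaw = inner ℝ e g := by
  have hterm : ∀ l m : Fin n,
      ∫ v : Vec n, e l * g m * (1 / v l * v m) ∂p.pertLaw = if l = m then e l * g m else 0 := by
    intro l m
    rw [integral_const_mul]
    split_ifs with hlm
    · rw [← hlm, hp.integral_inv_mul_self, mul_one]
    · rw [hp.integral_inv_mul_of_ne hlm, mul_zero]
  have hint : ∀ l m : Fin n, Integrable (fun v : Vec n => e l * g m * (1 / v l * v m)) p.pertLaw :=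
    fun l m => (hp.integrable_inv_mul l m).const_mul _
  simp only [inner_invVec_mul_inner]
  rw [integral_finsetSum _ fun l _ => integrable_finsetSum _ fun m _ => hint l m]
  simp only [integral_finsetSum _ fun m _ => hint _ m, hterm, Finset.sum_ite_eq, Finset.mem_univ,
    if_true, PiLp.inner_apply, RCLike.inner_apply, conj_trivial, mul_comm]

theorem Valid.integrable_sq_invVec_apply (hp : p.Valid D ξ₁ ξ₂) (l : Fin n) :
    Integrable (fun v : Vec n => invVec v l ^ 2) p.pertLaw :=
  (hp.measurePreserving_apply_pertLaw l).integrable_comp_of_integrable hp.memLp_inv.integrable_sq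

theorem Valid.integrable_norm_sq_invVec (hp : p.Valid D ξ₁ ξ₂) :
    Integrable (fun v : Vec n => ‖invVec v‖ ^ 2) p.pertLaw := by
  simp only [EuclideanSpace.real_norm_sq_eq]
  exact integrable_finsetSum _ fun l _ => hp.integrable_sq_invVec_apply l

theorem Valid.integral_norm_sq_invVec_le (hp : p.Valid D ξ₁ ξ₂) (hξ₂ : 0 ≤ ξ₂) :
    ∫ v : Vec n, ‖invVec v‖ ^ 2 ∂p.pertLaw ≤ n * ξ₂ := by
  have hcoord : ∀ l : Fin n, ∫ v : Vec n, invVec v l ^ 2 ∂p.pertLaw ≤ ξ₂ := fun l => by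
    refine le_of_eq_of_le ?_ (hp.integral_inv_sq_le hξ₂)
    rw [← (hp.measurePreserving_apply_pertLaw l).map_eq,
      integral_map (by fun_prop) (by fun_prop)]
    rfl
  calc ∫ v : Vec n, ‖invVec v‖ ^ 2 ∂p.pertLaw
      = ∑ l, ∫ v : Vec n, invVec v l ^ 2 ∂p.pertLaw := by
        simp only [EuclideanSpace.real_norm_sq_eq]
        exact integral_finsetSum _ fun l _ => hp.integrable_sq_invVec_apply l
    _ ≤ ∑ _l : Fin n, ξ₂ := Finset.sum_le_sum fun l _ => hcoord l
    _ = n * ξ₂ := by simp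

end PerturbationLaw

end MSPSA

theorem norm_sq_le_of_abs_le {ι : Type*} [Fintype ι] {v : EuclideanSpace ℝ ι} {ξ : ℝ}
    (h : ∀ l, |v l| ≤ ξ) : ‖v‖ ^ 2 ≤ Fintype.card ι * ξ ^ 2 := calc
  ‖v‖ ^ 2 = ∑ l, |v l| ^ 2 := by simp only [EuclideanSpace.real_norm_sq_eq, sq_abs]
  _ ≤ ∑ _l : ι, ξ ^ 2 := by gcongr; exact h _
  _ = Fintype.card ι * ξ ^ 2 := by simp

section StochasticApproximation

variable {E : Type*} [NormedAddCommGroup E] [InnerProductSpace ℝ E] {α β : Type*}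
  [MeasurableSpace α] [MeasurableSpace β]

theorem norm_sub_smul_sq (e u : E) (r : ℝ) :
    ‖e - r • u‖ ^ 2 = ‖e‖ ^ 2 - 2 * inner ℝ e u * r + ‖u‖ ^ 2 * r ^ 2 := by
  rw [norm_sub_sq_real, inner_smul_right, norm_smul, mul_pow, Real.norm_eq_abs, sq_abs]
  ring

section

variable {Q : Measure α} [IsProbabilityMeasure Q] {F : α → ℝ}

theorem integrable_norm_sub_smul_sq (hF : MemLp F 2 Q) (e u : E) :
    Integrable (fun z => ‖e - F z • u‖ ^ 2) Q := by
  simp only [norm_sub_smul_sq]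
  exact ((integrable_const _).sub ((hF.integrable one_le_two).const_mul _)).add
    (hF.integrable_sq.const_mul _)

theorem integral_norm_sub_smul_sq (hF : MemLp F 2 Q) (e u : E) :
    ∫ z, ‖e - F z • u‖ ^ 2 ∂Q =
      ‖e‖ ^ 2 - 2 * inner ℝ e u * ∫ z, F z ∂Q + ‖u‖ ^ 2 * ∫ z, F z ^ 2 ∂Q := by
  have hlin : Integrable (fun z => 2 * inner ℝ e u * F z) Q :=
    (hF.integrable one_le_two).const_mul _
  simp only [norm_sub_smul_sq]
  rw [integral_add (by exact (integrable_const _).sub hlin) (hF.integrable_sq.const_mul _),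
    integral_sub (integrable_const _) hlin, integral_const_mul, integral_const_mul, integral_const,
    probReal_univ, one_smul]

end

variable {Q : Measure α} {Q' : Measure β} [IsProbabilityMeasure Q] [IsProbabilityMeasure Q']
  {f : α → ℝ} {g : β → ℝ}

theorem memLp_sub_prod (hf : MemLp f 2 Q) (hg : MemLp g 2 Q') :
    MemLp (fun z : α × β => f z.1 - g z.2) 2 (Q.prod Q') :=
  (hf.comp_fst Q').sub (hg.comp_snd Q)

theorem integral_sub_prod (hf : MemLp f 2 Q) (hg : MemLp g 2 Q') :
    ∫ z, (f z.1 - g z.2) ∂(Q.prod Q') = ∫ z, f z ∂Q - ∫ z, g z ∂Q' := by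
  rw [integral_sub ((hf.integrable one_le_two).comp_fst Q') ((hg.integrable one_le_two).comp_snd Q),
    integral_fun_fst, integral_fun_snd]
  simp

theorem integral_sub_sq_prod_le (hf : MemLp f 2 Q) (hg : MemLp g 2 Q') :
    ∫ z, (f z.1 - g z.2) ^ 2 ∂(Q.prod Q') ≤ 2 * (∫ z, f z ^ 2 ∂Q + ∫ z, g z ^ 2 ∂Q') := by
  have hf2 : Integrable (fun z : α × β => f z.1 ^ 2) (Q.prod Q') := hf.integrable_sq.comp_fst Q'
  have hg2 : Integrable (fun z : α × β => g z.2 ^ 2) (Q.prod Q') := hg.integrable_sq.comp_snd Q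
  calc ∫ z, (f z.1 - g z.2) ^ 2 ∂(Q.prod Q')
      ≤ ∫ z : α × β, 2 * (f z.1 ^ 2 + g z.2 ^ 2) ∂(Q.prod Q') := by
        refine integral_mono (memLp_sub_prod hf hg).integrable_sq ((hf2.add hg2).const_mul 2) ?_
        intro z
        nlinarith [sq_nonneg (f z.1 + g z.2)]
    _ = 2 * (∫ z, f z ^ 2 ∂Q + ∫ z, g z ^ 2 ∂Q') := by
        rw [integral_const_mul, integral_add hf2 hg2, integral_fun_fst (fun z => f z ^ 2),
          integral_fun_snd (fun z => g z ^ 2)]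
        simp

variable (e u : E) (h : ℝ)

theorem integral_norm_sub_smul_sub_sq_le (hf : MemLp f 2 Q) (hg : MemLp g 2 Q') {S : ℝ}
    (hfS : ∫ z, f z ^ 2 ∂Q ≤ S) (hgS : ∫ z, g z ^ 2 ∂Q' ≤ S) :
    ∫ z, ‖e - (h * (f z.1 - g z.2)) • u‖ ^ 2 ∂(Q.prod Q') ≤
      ‖e‖ ^ 2 - 2 * h * inner ℝ e u * (∫ z, f z ∂Q - ∫ z, g z ∂Q') + 4 * S * h ^ 2 * ‖u‖ ^ 2 := by
  rw [integral_norm_sub_smul_sq ((memLp_sub_prod hf hg).const_mul h)]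
  simp only [mul_pow]
  rw [integral_const_mul, integral_const_mul, integral_sub_prod hf hg]
  have hvar : ∫ z, (f z.1 - g z.2) ^ 2 ∂(Q.prod Q') ≤ 4 * S := by
    linarith [integral_sub_sq_prod_le hf hg]
  have := mul_le_mul_of_nonneg_left hvar (by positivity : 0 ≤ ‖u‖ ^ 2 * h ^ 2)
  linarith

theorem lintegral_enorm_sub_smul_sub_sq (hf : MemLp f 2 Q) (hg : MemLp g 2 Q') :
    ∫⁻ z, ∫⁻ z', ‖e - (h * (f z - g z')) • u‖ₑ ^ 2 ∂Q' ∂Q =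
      ENNReal.ofReal (∫ z, ‖e - (h * (f z.1 - g z.2)) • u‖ ^ 2 ∂(Q.prod Q')) := by
  have hint := integrable_norm_sub_smul_sq ((memLp_sub_prod hf hg).const_mul h) e u
  rw [ofReal_integral_eq_lintegral_ofReal hint (ae_of_all _ fun _ => sq_nonneg _),
    lintegral_prod _ hint.aestronglyMeasurable.aemeasurable.ennreal_ofReal]
  simp only [ENNReal.ofReal_pow (norm_nonneg _), ofReal_norm]

end StochasticApproximation

/-! ### One pair of searches -/

namespace MSPSA

section Step

variable {K n : ℕ} (p : MSPSA K n) (D : Set (Vec n)) (I : Model K n)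

/-- The estimate that MSPSA computes after the `k`-th pair of searches in state `i`, from the
current estimate `x`, the observed costs `dPlus` and `dMinus`, and the perturbation `v`. -/
noncomputable def newEst (i : Fin K) (k : ℕ) (x : Vec n) (dPlus dMinus : ℝ) (v : Vec n) : Vec n :=
  euclProj D (x - (p.stepGain i k * ((dPlus - dMinus) / p.pertGain i k)) • invVec v)

/-- The mean of `V` at the next estimate when the first search of the `k`-th pair in state `i` has
returned the cost `d` and the second one is still to come. -/
noncomputable def halfPairCost (V : Vec n → ℝ≥0∞) (i : Fin K) (k : ℕ) (x : Vec n) (d : ℝ)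
    (v : Vec n) : ℝ≥0∞ :=
  ∫⁻ z, V (p.newEst D i k x d (I.obsCost (x - p.pertGain i k • v) z) v) ∂I.nextLaw i

/-- The mean of `V` at the next estimate before the `k`-th pair of searches in state `i`, for
perturbation `v`. -/
noncomputable def pairCost (V : Vec n → ℝ≥0∞) (i : Fin K) (k : ℕ) (x v : Vec n) : ℝ≥0∞ :=
  ∫⁻ z, p.halfPairCost D I V i k x (I.obsCost (x + p.pertGain i k • v) z) v ∂I.nextLaw i

variable {p D I} {Θ : Set (Params K n)} {σw ξ₁ ξ₂ : ℝ}

theorem Valid.pertGain_nonneg (hp : p.Valid D ξ₁ ξ₂) (i : Fin K) (k : ℕ) :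
    0 ≤ p.pertGain i k :=
  div_nonneg (hp.γ'_pos i).le (Real.rpow_nonneg (by positivity) _)

theorem Valid.pertGain_pos (hp : p.Valid D ξ₁ ξ₂) (i : Fin K) {k : ℕ} (hk : 1 ≤ k) :
    0 < p.pertGain i k := by
  have : (1 : ℝ) ≤ k := by exact_mod_cast hk
  exact div_pos (hp.γ'_pos i) (Real.rpow_pos_of_pos (by positivity) _)

/-- By symmetry of the two searches and since the stage cost is quadratic, the difference quotient
has conditional mean exactly `2 ⟪v, hess (x - x*)⟫`. -/
theorem integral_norm_step_sq_le (h : I.Admissible Θ D σw) {i : Fin K} {k : ℕ}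
    (hc : p.pertGain i k ≠ 0) (x v : Vec n) {S : ℝ}
    (hS : ∫ z, I.obsCost (x + p.pertGain i k • v) z ^ 2 ∂I.nextLaw i ≤ S)
    (hS' : ∫ z, I.obsCost (x - p.pertGain i k • v) z ^ 2 ∂I.nextLaw i ≤ S) :
    ∫ z, ‖x - I.optInput i - (p.stepGain i k / p.pertGain i k *
        (I.obsCost (x + p.pertGain i k • v) z.1 - I.obsCost (x - p.pertGain i k • v) z.2)) •
          invVec v‖ ^ 2 ∂((I.nextLaw i).prod (I.nextLaw i)) ≤
      ‖x - I.optInput i‖ ^ 2 - 4 * p.stepGain i k * (inner ℝ (x - I.optInput i) (invVec v) *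
        inner ℝ v ((I.hess i).toEuclideanLin (x - I.optInput i))) +
      4 * S * (p.stepGain i k / p.pertGain i k) ^ 2 * ‖invVec v‖ ^ 2 := by
  have := h.isProbabilityMeasure_nextLaw i
  refine (integral_norm_sub_smul_sub_sq_le _ _ _ (h.memLp_obsCost _ i) (h.memLp_obsCost _ i)
    hS hS').trans_eq ?_
  rw [h.integral_obsCost, h.integral_obsCost, h.stageCost_add_sub_stageCost_sub, inner_smul_left]
  simp only [conj_trivial]
  field_simp
  ring

theorem pairCost_enorm_sub_sq_le (h : I.Admissible Θ D σw) (hD : IsClosed D) (hconv : Convex ℝ D)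
    (i : Fin K) (k : ℕ) (x v : Vec n) :
    p.pairCost D I (fun y => ‖y - I.optInput i‖ₑ ^ 2) i k x v ≤
      ENNReal.ofReal (∫ z, ‖x - I.optInput i - (p.stepGain i k / p.pertGain i k *
        (I.obsCost (x + p.pertGain i k • v) z.1 - I.obsCost (x - p.pertGain i k • v) z.2)) •
          invVec v‖ ^ 2 ∂((I.nextLaw i).prod (I.nextLaw i))) := by
  have := h.isProbabilityMeasure_nextLaw i
  rw [← lintegral_enorm_sub_smul_sub_sq _ _ _ (h.memLp_obsCost _ i) (h.memLp_obsCost _ i)]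
  refine lintegral_mono fun z => lintegral_mono fun z' => ?_
  refine pow_le_pow_left' (enorm_le_iff_norm_le.2 ?_) 2
  refine (norm_euclProj_sub_le hD hconv _ (h.optInput_mem i)).trans_eq ?_
  rw [sub_right_comm, mul_div_assoc', mul_div_right_comm]

section

variable (e g : Vec n) (a : ℝ) {b : ℝ}

theorem Valid.integrable_stepErrorBound (hp : p.Valid D ξ₁ ξ₂) :
    Integrable (fun v => ‖e‖ ^ 2 - a * (inner ℝ e (invVec v) * inner ℝ v g) + b * ‖invVec v‖ ^ 2)
      p.pertLaw :=
  have := hp.isProbabilityMeasure_pertLaw (n := n)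
  ((integrable_const _).sub ((hp.integrable_inner_invVec_mul_inner e g).const_mul _)).add
    (hp.integrable_norm_sq_invVec.const_mul _)

theorem Valid.integral_stepErrorBound_le (hp : p.Valid D ξ₁ ξ₂) (hξ₂ : 0 ≤ ξ₂) (hb : 0 ≤ b) :
    ∫ v, (‖e‖ ^ 2 - a * (inner ℝ e (invVec v) * inner ℝ v g) + b * ‖invVec v‖ ^ 2) ∂p.pertLaw ≤
      ‖e‖ ^ 2 - a * inner ℝ e g + b * (n * ξ₂) := by
  have := hp.isProbabilityMeasure_pertLaw (n := n)
  have hlin : Integrable (fun v => a * (inner ℝ e (invVec v) * inner ℝ v g)) p.pertLaw :=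
    (hp.integrable_inner_invVec_mul_inner e g).const_mul _
  have hsq : Integrable (fun v : Vec n => b * ‖invVec v‖ ^ 2) p.pertLaw :=
    hp.integrable_norm_sq_invVec.const_mul _
  rw [integral_add (by exact (integrable_const _).sub hlin) hsq,
    integral_sub (integrable_const _) hlin, integral_const_mul, integral_const_mul,
    hp.integral_inner_invVec_mul_inner, integral_const, probReal_univ, one_smul]
  gcongr
  exact hp.integral_norm_sq_invVec_le hξ₂

end

theorem Valid.norm_sq_le_stepGain_mul_inner_hess (hp : p.Valid D ξ₁ ξ₂)
    (h : I.Admissible Θ D σw) (hstep : p.StepCondition I) (i : Fin K) (k : ℕ) (e : Vec n) :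
    1 / (p.N i + k) * ‖e‖ ^ 2 ≤
      4 * p.stepGain i k * inner ℝ e ((I.hess i).toEuclideanLin e) := calc
  1 / (p.N i + k) * ‖e‖ ^ 2
    ≤ 1 / (p.N i + k) * (4 * p.γ i * inner ℝ e ((I.hess i).toEuclideanLin e)) := by
      gcongr
      exact h.norm_sq_le_inner_hess hp.γ_pos hstep i e
  _ = 4 * p.stepGain i k * inner ℝ e ((I.hess i).toEuclideanLin e) := by rw [stepGain]; ring

theorem Valid.lintegral_pairCost_enorm_sub_sq_le (hp : p.Valid D ξ₁ ξ₂) (hξ₂ : 0 ≤ ξ₂)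
    (hD : IsClosed D) (hconv : Convex ℝ D) (h : I.Admissible Θ D σw) (hstep : p.StepCondition I)
    (i : Fin K) {k : ℕ} (hk : 1 ≤ k) (x : Vec n) {S : ℝ} (hS₀ : 0 ≤ S)
    (hS : ∀ v : Vec n, (∀ l, |v l| ≤ ξ₁) →
      ∫ z, I.obsCost (x + p.pertGain i k • v) z ^ 2 ∂I.nextLaw i ≤ S ∧
      ∫ z, I.obsCost (x - p.pertGain i k • v) z ^ 2 ∂I.nextLaw i ≤ S) :
    ∫⁻ v, p.pairCost D I (fun y => ‖y - I.optInput i‖ₑ ^ 2) i k x v ∂p.pertLaw ≤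
      ENNReal.ofReal ((1 - 1 / (p.N i + k)) * ‖x - I.optInput i‖ ^ 2 +
        4 * S * (p.stepGain i k / p.pertGain i k) ^ 2 * (n * ξ₂)) := by
  set e := x - I.optInput i
  set g := (I.hess i).toEuclideanLin e
  set b := 4 * S * (p.stepGain i k / p.pertGain i k) ^ 2
  let G : Vec n → ℝ := fun v =>
    ‖e‖ ^ 2 - 4 * p.stepGain i k * (inner ℝ e (invVec v) * inner ℝ v g) + b * ‖invVec v‖ ^ 2
  have hstep_le : ∀ᵐ v ∂p.pertLaw, ∫ z, ‖e - (p.stepGain i k / p.pertGain i k *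
      (I.obsCost (x + p.pertGain i k • v) z.1 - I.obsCost (x - p.pertGain i k • v) z.2)) •
        invVec v‖ ^ 2 ∂((I.nextLaw i).prod (I.nextLaw i)) ≤ G v := by
    filter_upwards [hp.ae_pertLaw hp.ν_bdd] with v hv
    exact integral_norm_step_sq_le h (hp.pertGain_pos i hk).ne' x v (hS v hv).1 (hS v hv).2
  calc ∫⁻ v, p.pairCost D I (fun y => ‖y - I.optInput i‖ₑ ^ 2) i k x v ∂p.pertLaw
      ≤ ∫⁻ v, ENNReal.ofReal (G v) ∂p.pertLaw := lintegral_mono_ae <| hstep_le.mono fun v hv =>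
        (pairCost_enorm_sub_sq_le h hD hconv i k x v).trans (ENNReal.ofReal_le_ofReal hv)
    _ = ENNReal.ofReal (∫ v, G v ∂p.pertLaw) :=
        (ofReal_integral_eq_lintegral_ofReal (hp.integrable_stepErrorBound e g _) <|
          hstep_le.mono fun v hv => (integral_nonneg fun _ => by positivity).trans hv).symm
    _ ≤ ENNReal.ofReal (‖e‖ ^ 2 - 4 * p.stepGain i k * inner ℝ e g + b * (n * ξ₂)) :=
        ENNReal.ofReal_le_ofReal (hp.integral_stepErrorBound_le e g _ hξ₂ (by positivity))
    _ ≤ _ := by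
        have hcurv := hp.norm_sq_le_stepGain_mul_inner_hess h hstep i k e
        gcongr
        linarith

end Step

end MSPSA

/-! ### Measurability and locality of the memory -/

@[fun_prop]
theorem measurable_update_comp {ι α β : Type*} [DecidableEq ι] [MeasurableSpace α]
    [MeasurableSpace β] {f : α → ι → β} {x : α → β} (hf : Measurable f) (i : ι)
    (hx : Measurable x) : Measurable fun a => Function.update (f a) i (x a) := by
  simpa only [Function.comp_def] using
    (measurable_update' (a := i) (X := fun _ : ι => β)).comp (hf.prodMk hx)

namespace MSPSA

variable {K n : ℕ}

namespace Memory

instance : MeasurableSpace (Memory K n) :=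
  MeasurableSpace.comap (fun m => (m.count, m.flag, m.est, m.dPlus)) inferInstance

theorem measurable_fields :
    Measurable fun m : Memory K n => (m.count, m.flag, m.est, m.dPlus) := comap_measurable _

@[fun_prop]
theorem measurable_count : Measurable fun m : Memory K n => m.count := measurable_fields.fst

@[fun_prop]
theorem measurable_flag : Measurable fun m : Memory K n => m.flag := measurable_fields.snd.fst

@[fun_prop]
theorem measurable_est : Measurable fun m : Memory K n => m.est := measurable_fields.snd.snd.fst

@[fun_prop]
theorem measurable_dPlus : Measurable fun m : Memory K n => m.dPlus :=
  measurable_fields.snd.snd.snd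

variable {α : Type*} [MeasurableSpace α]

theorem measurable_mk {c : α → Fin K → ℕ} {f : α → Fin K → Bool} {x : α → Fin K → Vec n}
    {d : α → Fin K → ℝ} (hc : Measurable c) (hf : Measurable f) (hx : Measurable x)
    (hd : Measurable d) : Measurable fun a => (⟨c a, f a, x a, d a⟩ : Memory K n) := by
  rw [measurable_comap_iff]
  exact hc.prodMk (hf.prodMk (hx.prodMk hd))

end Memory

section Dynamics

variable (p : MSPSA K n) (D : Set (Vec n))

theorem input_of_flag_true {m : Memory K n} {i : Fin K} (h : m.flag i = true)
    (δ : Fin K → ℕ → Vec n) :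
    p.input m δ i = m.est i - p.pertGain i (m.count i) • δ i (m.count i) := by
  simp only [input, h, if_true]

theorem input_of_flag_false {m : Memory K n} {i : Fin K} (h : m.flag i = false)
    (δ : Fin K → ℕ → Vec n) :
    p.input m δ i = m.est i + p.pertGain i (m.count i + 1) • δ i (m.count i + 1) := by
  simp only [input, h, Bool.false_eq_true, if_false]

theorem update_of_flag_true {m : Memory K n} {i : Fin K} (h : m.flag i = true)
    (δ : Fin K → ℕ → Vec n) (y : Vec n) :
    p.update D m δ i y =
      { m with
        flag := Function.update m.flag i false
        est := Function.update m.est i (p.newEst D i (m.count i) (m.est i) (m.dPlus i)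
          (-inner ℝ (m.est i - p.pertGain i (m.count i) • δ i (m.count i)) y)
          (δ i (m.count i))) } := by
  simp only [update, input, h, if_true]
  rfl

theorem update_of_flag_false {m : Memory K n} {i : Fin K} (h : m.flag i = false)
    (δ : Fin K → ℕ → Vec n) (y : Vec n) :
    p.update D m δ i y =
      { m with
        count := Function.update m.count i (m.count i + 1)
        flag := Function.update m.flag i true
        dPlus := Function.update m.dPlus i
          (-inner ℝ (m.est i + p.pertGain i (m.count i + 1) • δ i (m.count i + 1)) y) } := by
  simp only [update, input, h, Bool.false_eq_true, if_false]

variable {α : Type*} [MeasurableSpace α] {m : α → Memory K n} {δ : α → Fin K → ℕ → Vec n}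
  {i : α → Fin K} {D}

theorem measurable_input (hm : Measurable m) (hδ : Measurable δ) (hi : Measurable i) :
    Measurable fun a => p.input (m a) (δ a) (i a) := by
  refine measurable_apply_of_countable (F := fun i a => p.input (m a) (δ a) i) (fun i => ?_) hi
  refine Measurable.ite ?_ (.sub (by fun_prop) ?_) (.add (by fun_prop) ?_)
  · exact (show Measurable fun a => (m a).flag i by fun_prop) (measurableSet_singleton true)
  · exact measurable_apply_of_countable (F := fun k a => p.pertGain i k • δ a i k)
      (i := fun a => (m a).count i) (fun k => by fun_prop) (by fun_prop)
  · exact measurable_apply_of_countable (F := fun k a => p.pertGain i (k + 1) • δ a i (k + 1))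
      (i := fun a => (m a).count i) (fun k => by fun_prop) (by fun_prop)

@[fun_prop]
theorem measurable_invVec : Measurable (invVec : Vec n → Vec n) := by
  unfold invVec
  fun_prop

@[fun_prop]
theorem measurable_newEst (hD : Measurable (euclProj D)) (i : Fin K) (k : ℕ) {x v : α → Vec n}
    {d d' : α → ℝ} (hx : Measurable x) (hd : Measurable d) (hd' : Measurable d')
    (hv : Measurable v) : Measurable fun a => p.newEst D i k (x a) (d a) (d' a) (v a) := by
  unfold newEst
  fun_prop

theorem measurable_update (hD : Measurable (euclProj D)) (hm : Measurable m)
    (hδ : Measurable δ) (hi : Measurable i) {y : α → Vec n} (hy : Measurable y) :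
    Measurable fun a => p.update D (m a) (δ a) (i a) (y a) := by
  refine measurable_apply_of_countable (F := fun i a => p.update D (m a) (δ a) i (y a))
    (fun i => ?_) hi
  have hinput := p.measurable_input hm hδ (measurable_const (a := i))
  unfold update
  refine Measurable.ite ?_ ?_ ?_
  · exact (show Measurable fun a => (m a).flag i by fun_prop) (measurableSet_singleton true)
  · refine Memory.measurable_mk (by fun_prop) (by fun_prop)
      (measurable_update_comp (by fun_prop) i ?_) (by fun_prop)
    exact measurable_apply_of_countable (F := fun k a => p.newEst D i k ((m a).est i)
      ((m a).dPlus i) (-inner ℝ (p.input (m a) (δ a) i) (y a)) (δ a i k))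
      (i := fun a => (m a).count i) (fun k => by fun_prop (disch := assumption)) (by fun_prop)
  · exact Memory.measurable_mk (by fun_prop) (by fun_prop) (by fun_prop)
      (measurable_update_comp (by fun_prop) i (by fun_prop))

variable (I : Model K n)

theorem measurable_memory (hD : Measurable (euclProj D)) {s : ℕ → α → Fin K} {w : ℕ → α → Vec n}
    (hδ : Measurable δ) (t : ℕ) (hs : ∀ r ≤ t, Measurable (s r))
    (hw : ∀ r < t, Measurable (w (r + 1))) :
    Measurable fun a => p.memory D I (fun r => s r a) (fun r => w r a) (δ a) t := by
  induction t with
  | zero => exact measurable_const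
  | succ t ih =>
    have hmem := ih (fun r hr => hs r (by lia)) fun r hr => hw r (by lia)
    have hst := hs t t.le_succ
    exact p.measurable_update hD hmem hδ hst <| I.measurable_output (hs (t + 1) le_rfl)
      (p.measurable_input hmem hδ hst) (hw t (by lia))

end Dynamics

section Deterministic

variable (p : MSPSA K n) (D : Set (Vec n)) (I : Model K n) (s : ℕ → Fin K) (w : ℕ → Vec n)

theorem update_est_mem {D : Set (Vec n)} (hD : IsClosed D) (hne : D.Nonempty) {m : Memory K n}
    (hm : ∀ j, m.est j ∈ D) (δ : Fin K → ℕ → Vec n) (i : Fin K) (y : Vec n) (j : Fin K) :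
    (p.update D m δ i y).est j ∈ D := by
  cases h : m.flag i
  · rw [update_of_flag_false p D h]
    exact hm j
  · rw [update_of_flag_true p D h]
    simp only [Function.update_apply]
    split_ifs
    · exact euclProj_mem hD hne _
    · exact hm j

theorem memory_est_mem {D : Set (Vec n)} (hD : IsClosed D) (hx : ∀ i, p.xInit i ∈ D)
    (δ : Fin K → ℕ → Vec n) (t : ℕ) (j : Fin K) : (p.memory D I s w δ t).est j ∈ D := by
  induction t generalizing j with
  | zero => exact hx j
  | succ t ih => exact p.update_est_mem hD ⟨_, hx j⟩ ih _ _ _ j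

theorem le_update_count (m : Memory K n) (δ : Fin K → ℕ → Vec n) (i : Fin K) (y : Vec n) :
    m.count ≤ (p.update D m δ i y).count := by
  cases h : m.flag i
  · rw [update_of_flag_false p D h]
    exact le_update_self_iff.2 (Nat.le_succ _)
  · rw [update_of_flag_true p D h]

theorem update_count_le (m : Memory K n) (δ : Fin K → ℕ → Vec n) (i : Fin K) (y : Vec n)
    (j : Fin K) : (p.update D m δ i y).count j ≤ m.count j + 1 := by
  cases h : m.flag i
  · rw [update_of_flag_false p D h]
    simp only [Function.update_apply]
    split_ifs with hj
    · rw [hj]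
    · exact Nat.le_succ _
  · rw [update_of_flag_true p D h]
    exact Nat.le_succ _

theorem memory_count_le (δ : Fin K → ℕ → Vec n) (t : ℕ) (j : Fin K) :
    (p.memory D I s w δ t).count j ≤ t := by
  induction t with
  | zero => exact le_rfl
  | succ t ih => exact (p.update_count_le D _ δ _ _ j).trans (Nat.succ_le_succ ih)

variable {δ δ' : Fin K → ℕ → Vec n}

theorem input_congr {m : Memory K n} {i : Fin K} {y : Vec n}
    (h : δ i ((p.update D m δ i y).count i) = δ' i ((p.update D m δ i y).count i)) :
    p.input m δ i = p.input m δ' i := by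
  cases hf : m.flag i
  · simp only [update_of_flag_false p D hf, Function.update_self] at h
    rw [input_of_flag_false p hf, input_of_flag_false p hf, h]
  · rw [update_of_flag_true p D hf] at h
    rw [input_of_flag_true p hf, input_of_flag_true p hf, h]

theorem update_congr {m : Memory K n} {i : Fin K} {y : Vec n}
    (h : δ i ((p.update D m δ i y).count i) = δ' i ((p.update D m δ i y).count i)) :
    p.update D m δ i y = p.update D m δ' i y := by
  cases hf : m.flag i
  · simp only [update_of_flag_false p D hf, Function.update_self] at h
    rw [update_of_flag_false p D hf, update_of_flag_false p D hf, h]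
  · rw [update_of_flag_true p D hf] at h
    rw [update_of_flag_true p D hf, update_of_flag_true p D hf, h]

theorem memory_congr (t : ℕ)
    (h : ∀ j, ∀ k ≤ (p.memory D I s w δ t).count j, δ j k = δ' j k) :
    p.memory D I s w δ t = p.memory D I s w δ' t := by
  induction t with
  | zero => rfl
  | succ t ih =>
    have hprev := ih fun j k hk => h j k (hk.trans (p.le_update_count D _ δ _ _ j))
    have hused := h (s t) _ le_rfl
    simp only [memory] at hused ⊢
    rw [← hprev, ← p.input_congr D hused, p.update_congr D hused]

end Deterministic

section Measurability

variable (p : MSPSA K n) {D : Set (Vec n)} {I : Model K n} {Θ : Set (Params K n)} {σw : ℝ}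
  {α : Type*} [MeasurableSpace α] {V : Vec n → ℝ≥0∞} {x v : α → Vec n}

theorem measurable_halfPairCost (h : I.Admissible Θ D σw) (hD : Measurable (euclProj D))
    (hV : Measurable V) (i : Fin K) (k : ℕ) {d : α → ℝ} (hx : Measurable x) (hd : Measurable d)
    (hv : Measurable v) : Measurable fun a => p.halfPairCost D I V i k (x a) (d a) (v a) := by
  have := h.isProbabilityMeasure_nextLaw i
  unfold halfPairCost
  exact Measurable.lintegral_prod_right' (f := fun q : α × (Fin K × Vec n) =>
    V (p.newEst D i k (x q.1) (d q.1) (I.obsCost (x q.1 - p.pertGain i k • v q.1) q.2) (v q.1)))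
    (by fun_prop (disch := assumption))

theorem measurable_pairCost (h : I.Admissible Θ D σw) (hD : Measurable (euclProj D))
    (hV : Measurable V) (i : Fin K) (k : ℕ) (hx : Measurable x) (hv : Measurable v) :
    Measurable fun a => p.pairCost D I V i k (x a) (v a) := by
  have := h.isProbabilityMeasure_nextLaw i
  unfold pairCost
  exact Measurable.lintegral_prod_right' (f := fun q : α × (Fin K × Vec n) =>
    p.halfPairCost D I V i k (x q.1) (I.obsCost (x q.1 + p.pertGain i k • v q.1) q.2) (v q.1))
    (p.measurable_halfPairCost h hD hV i k (by fun_prop) (by fun_prop) (by fun_prop))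

end Measurability

end MSPSA

/-! ### The Markov property -/

namespace Realization

section Markov

variable {K n : ℕ} {I : Model K n} {ν : Measure ℝ} (R : Realization I ν)

/-- The state and the noise at time `t`. -/
def obs (t : ℕ) (ω : R.Ω) : Fin K × Vec n := (R.s t ω, R.w t ω)

/-- All perturbation vectors. -/
def pert (ω : R.Ω) : Fin K → ℕ → Vec n := fun i k => R.δ i k ω

/-- The sequences of states and of noises. -/
def sys (ω : R.Ω) : (ℕ → Fin K) × (ℕ → Vec n) := (fun t => R.s t ω, fun t => R.w t ω)

/-- The event that the states up to time `t` follow `j` and the noises lie in the sets `B`. -/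
def path (t : ℕ) (j : ℕ → Fin K) (B : ℕ → Set (Vec n)) : Set R.Ω :=
  {ω | ∀ r ≤ t, R.s r ω = j r} ∩ {ω | ∀ r < t, R.w (r + 1) ω ∈ B (r + 1)}

@[fun_prop]
theorem measurable_obs (t : ℕ) : Measurable (R.obs t) := (R.meas_s t).prodMk (R.meas_w t)

@[fun_prop]
theorem measurable_pert : Measurable R.pert :=
  measurable_pi_lambda _ fun i => measurable_pi_lambda _ fun k => R.meas_δ i k

@[fun_prop]
theorem measurable_sys : Measurable R.sys :=
  (measurable_pi_lambda _ fun t => R.meas_s t).prodMk (measurable_pi_lambda _ fun t => R.meas_w t)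

theorem indepFun_pert_sys : IndepFun R.pert R.sys R.μ := R.δ_indep_system

theorem measurableSet_comap_sys_path (t : ℕ) (j : ℕ → Fin K) {B : ℕ → Set (Vec n)}
    (hB : ∀ r, MeasurableSet (B r)) :
    MeasurableSet[MeasurableSpace.comap R.sys inferInstance] (R.path t j B) := by
  refine ⟨{q | ∀ r ≤ t, q.1 r = j r} ∩ {q | ∀ r < t, q.2 (r + 1) ∈ B (r + 1)}, ?_, rfl⟩
  simp only [Set.ofPred_forall]
  refine .inter (.iInter fun r => .iInter fun _ => ?_) (.iInter fun r => .iInter fun _ => ?_)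
  · exact measurableSet_eq_fun (by fun_prop) measurable_const
  · exact ((measurable_pi_apply (r + 1)).comp measurable_snd) (hB _)

theorem measurableSet_path (t : ℕ) (j : ℕ → Fin K) {B : ℕ → Set (Vec n)}
    (hB : ∀ r, MeasurableSet (B r)) : MeasurableSet (R.path t j B) :=
  R.measurable_sys.comap_le _ (R.measurableSet_comap_sys_path t j hB)

theorem path_congr {t : ℕ} {j j' : ℕ → Fin K} {B B' : ℕ → Set (Vec n)}
    (hj : ∀ r ≤ t, j r = j' r) (hB : ∀ r < t, B (r + 1) = B' (r + 1)) :
    R.path t j B = R.path t j' B' := by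
  ext ω
  exact and_congr (forall₂_congr fun r hr => by rw [hj r hr])
    (forall₂_congr fun r hr => by rw [hB r hr])

theorem path_succ (t : ℕ) (j : ℕ → Fin K) (B : ℕ → Set (Vec n)) :
    R.path (t + 1) j B = R.path t j B ∩ R.obs (t + 1) ⁻¹' ({j (t + 1)} ×ˢ B (t + 1)) := by
  ext ω
  simp only [path, obs, Set.mem_inter_iff, Set.mem_ofPred_eq, Set.mem_preimage, Set.mem_prod,
    Set.mem_singleton_iff, Nat.le_succ_iff_eq_or_le, Nat.lt_succ_iff_lt_or_eq, or_imp, forall_and,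
    forall_eq]
  tauto

theorem measure_path_succ (t : ℕ) (j : ℕ → Fin K) {B : ℕ → Set (Vec n)}
    (hB : ∀ r, MeasurableSet (B r)) :
    R.μ (R.path (t + 1) j B) = R.μ (R.path t j B) *
      (ENNReal.ofReal (I.P (j t) (j (t + 1))) * I.f (j (t + 1)) (B (t + 1))) := by
  rw [path, path, R.law _ j B hB, R.law t j B hB, Finset.prod_range_succ, mul_assoc]

theorem measure_path_inter_obs_prod (t : ℕ) (j : ℕ → Fin K) {B : ℕ → Set (Vec n)}
    (hB : ∀ r, MeasurableSet (B r)) (j' : Fin K) {C : Set (Vec n)} (hC : MeasurableSet C) :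
    R.μ (R.path t j B ∩ R.obs (t + 1) ⁻¹' ({j'} ×ˢ C)) =
      R.μ (R.path t j B) * (ENNReal.ofReal (I.P (j t) j') * I.f j' C) := by
  let j₁ := Function.update j (t + 1) j'
  let B₁ := Function.update B (t + 1) C
  have hB₁ : ∀ r, MeasurableSet (B₁ r) :=
    (Function.forall_update_iff B fun _ S => MeasurableSet S).2 ⟨hC, fun r _ => hB r⟩
  have hpath : R.path t j B = R.path t j₁ B₁ :=
    R.path_congr (fun r hr => (Function.update_of_ne (by lia) _ _).symm)
      fun r hr => (Function.update_of_ne (by lia) _ _).symm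
  have hj₁ : j₁ t = j t := Function.update_of_ne (by lia) _ _
  simpa only [path_succ, hpath, hj₁, j₁, B₁, Function.update_self]
    using R.measure_path_succ t j₁ hB₁

theorem measure_path_inter_obs (t : ℕ) (j : ℕ → Fin K) {B : ℕ → Set (Vec n)}
    (hB : ∀ r, MeasurableSet (B r)) {V : Set (Fin K × Vec n)} (hV : MeasurableSet V) :
    R.μ (R.path t j B ∩ R.obs (t + 1) ⁻¹' V) = R.μ (R.path t j B) * I.nextLaw (j t) V := by
  let W : Fin K → Set (Fin K × Vec n) := fun j' => {j'} ×ˢ (Prod.mk j' ⁻¹' V)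
  have hVj : ∀ j', MeasurableSet (Prod.mk j' ⁻¹' V) := fun j' => measurable_prodMk_left hV
  have hW : ∀ j', MeasurableSet (W j') := fun j' => (measurableSet_singleton j').prod (hVj j')
  have hunion : V = ⋃ j', W j' := by
    ext ⟨j', w⟩
    simp [W]
  have hdisj : Pairwise (Function.onFun Disjoint
      fun j' => R.path t j B ∩ R.obs (t + 1) ⁻¹' W j') := fun j₁ j₂ hne =>
    ((Set.Disjoint.set_prod_left (Set.disjoint_singleton.2 hne) _ _).preimage _).mono
      Set.inter_subset_right Set.inter_subset_right
  conv_lhs => rw [hunion, Set.preimage_iUnion, Set.inter_iUnion]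
  rw [measure_iUnion hdisj fun j' =>
    (R.measurableSet_path t j hB).inter (R.measurable_obs _ (hW j')), tsum_fintype,
    I.nextLaw_apply _ hV, Finset.mul_sum]
  exact Finset.sum_congr rfl fun j' _ => R.measure_path_inter_obs_prod t j hB j' (hVj j')

/-- The events that generate the information available before stage `t + 1`, together with all
perturbation vectors. -/
def histSets (t : ℕ) : Set (Set R.Ω) :=
  {E | ∃ X, MeasurableSet X ∧ ∃ j B, (∀ r, MeasurableSet (B r)) ∧ E = R.pert ⁻¹' X ∩ R.path t j B}

/-- The information available before stage `t + 1`, together with all perturbation vectors. -/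
abbrev hist (t : ℕ) : MeasurableSpace R.Ω := MeasurableSpace.generateFrom (R.histSets t)

theorem measurableSet_of_mem_histSets {t : ℕ} {E : Set R.Ω} (hE : E ∈ R.histSets t) :
    MeasurableSet E := by
  obtain ⟨X, hX, j, B, hB, rfl⟩ := hE
  exact (R.measurable_pert hX).inter (R.measurableSet_path t j hB)

theorem hist_le (t : ℕ) : R.hist t ≤ R.mΩ :=
  MeasurableSpace.generateFrom_le fun _ hE => R.measurableSet_of_mem_histSets hE

theorem isPiSystem_histSets (t : ℕ) : IsPiSystem (R.histSets t) := by
  rintro _ ⟨X, hX, j, B, hB, rfl⟩ _ ⟨X', hX', j', B', hB', rfl⟩ ⟨ω₀, hω₀, hω₀'⟩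
  refine ⟨X ∩ X', hX.inter hX', j, fun r => B r ∩ B' r, fun r => (hB r).inter (hB' r), ?_⟩
  have hj : ∀ r ≤ t, j' r = j r := fun r hr => (hω₀'.2.1 r hr).symm.trans (hω₀.2.1 r hr)
  rw [R.path_congr hj fun _ _ => rfl, Set.inter_inter_inter_comm, Set.preimage_inter]
  congr 1
  ext ω
  simp only [path, Set.mem_inter_iff, Set.mem_ofPred_eq, forall_and]
  tauto

/-- The finite sequence `j`, continued arbitrarily. -/
def extend {t : ℕ} (j : Fin (t + 1) → Fin K) (r : ℕ) : Fin K := j (Fin.ofNat (t + 1) r)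

theorem mem_path_extend (t : ℕ) (ω : R.Ω) :
    ω ∈ R.path t (extend fun r : Fin (t + 1) => R.s r ω) fun _ => Set.univ := by
  refine ⟨fun r hr => ?_, fun _ _ => Set.mem_univ _⟩
  simp [extend, Fin.ofNat, Nat.mod_eq_of_lt (Nat.lt_succ_of_le hr)]

theorem measurableSet_hist_of_forall {t : ℕ} {E : Set R.Ω}
    (h : ∀ j : ℕ → Fin K, MeasurableSet[R.hist t] (E ∩ R.path t j fun _ => Set.univ)) :
    MeasurableSet[R.hist t] E := by
  have hE : E = ⋃ j : Fin (t + 1) → Fin K, E ∩ R.path t (extend j) fun _ => Set.univ := by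
    ext ω
    simp only [Set.mem_iUnion, Set.mem_inter_iff]
    exact ⟨fun hω => ⟨_, hω, R.mem_path_extend t ω⟩, fun ⟨_, hω, _⟩ => hω⟩
  rw [hE]
  exact MeasurableSet.iUnion fun j => h _

theorem measurableSet_hist_path (t : ℕ) (j : ℕ → Fin K) {B : ℕ → Set (Vec n)}
    (hB : ∀ r, MeasurableSet (B r)) : MeasurableSet[R.hist t] (R.path t j B) :=
  MeasurableSpace.measurableSet_generateFrom ⟨Set.univ, .univ, j, B, hB, by simp⟩

theorem measurable_hist_s {t r : ℕ} (hr : r ≤ t) : Measurable[R.hist t] (R.s r) := by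
  intro S _
  refine R.measurableSet_hist_of_forall fun j => ?_
  have hpath := R.measurableSet_hist_path t j (B := fun _ => Set.univ) fun _ => .univ
  by_cases hj : j r ∈ S
  · rwa [Set.inter_eq_right.2 fun ω hω => by rwa [Set.mem_preimage, hω.1 r hr]]
  · rw [Set.disjoint_iff_inter_eq_empty.1 (Set.disjoint_left.2 fun ω hω hω' =>
      hj (by rwa [Set.mem_preimage, hω'.1 r hr] at hω))]
    exact @MeasurableSet.empty _ (R.hist t)

theorem measurable_hist_w {t r : ℕ} (hr : r < t) : Measurable[R.hist t] (R.w (r + 1)) := by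
  intro C hC
  refine R.measurableSet_hist_of_forall fun j => ?_
  let B : ℕ → Set (Vec n) := Function.update (fun _ => Set.univ) (r + 1) C
  have hB : ∀ q, MeasurableSet (B q) :=
    (Function.forall_update_iff _ fun _ S => MeasurableSet S).2 ⟨hC, fun _ _ => .univ⟩
  have hmem : ∀ ω, (∀ q < t, R.w (q + 1) ω ∈ B (q + 1)) ↔ R.w (r + 1) ω ∈ C := fun ω => by
    refine ⟨fun h => by simpa [B] using h r hr, fun h q _ => ?_⟩
    rcases eq_or_ne q r with rfl | hne
    · simpa [B] using h
    · simp [B, hne]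
  convert R.measurableSet_hist_path t j hB using 1
  ext ω
  simp [path, hmem, and_comm]

theorem measurable_hist_pert (t : ℕ) : Measurable[R.hist t] R.pert := fun X hX =>
  R.measurableSet_hist_of_forall fun j => MeasurableSpace.measurableSet_generateFrom
    ⟨X, hX, j, fun _ => Set.univ, fun _ => MeasurableSet.univ, rfl⟩

theorem measure_histSets_inter {t : ℕ} {E : Set R.Ω} (hE : E ∈ R.histSets t)
    {V : Set (Fin K × Vec n)} (hV : MeasurableSet V) :
    R.μ (E ∩ R.obs (t + 1) ⁻¹' V) = ∫⁻ ω in E, I.nextLaw (R.s t ω) V ∂(R.μ) := by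
  have hEm := R.measurableSet_of_mem_histSets hE
  obtain ⟨X, hX, j, B, hB, rfl⟩ := hE
  have hindep : ∀ {F}, MeasurableSet[MeasurableSpace.comap R.sys inferInstance] F →
      R.μ (R.pert ⁻¹' X ∩ F) = R.μ (R.pert ⁻¹' X) * R.μ F := by
    rintro _ ⟨Y, hY, rfl⟩
    exact R.indepFun_pert_sys.measure_inter_preimage_eq_mul _ _ hX hY
  have hpath := R.measurableSet_comap_sys_path t j hB
  have hobs : MeasurableSet[MeasurableSpace.comap R.sys inferInstance] (R.obs (t + 1) ⁻¹' V) :=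
    ⟨{q | (q.1 (t + 1), q.2 (t + 1)) ∈ V}, (show Measurable
      fun q : (ℕ → Fin K) × (ℕ → Vec n) => (q.1 (t + 1), q.2 (t + 1)) by fun_prop) hV, rfl⟩
  have hlaw : ∀ ω ∈ R.pert ⁻¹' X ∩ R.path t j B,
      I.nextLaw (R.s t ω) V = I.nextLaw (j t) V := fun ω hω => by rw [hω.2.1 t le_rfl]
  rw [setLIntegral_congr_fun hEm hlaw, setLIntegral_const, Set.inter_assoc,
    hindep (hpath.inter hobs), R.measure_path_inter_obs t j hB hV, hindep hpath]
  ring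

theorem measure_hist_inter {t : ℕ} {E : Set R.Ω} (hE : MeasurableSet[R.hist t] E)
    {V : Set (Fin K × Vec n)} (hV : MeasurableSet V) :
    R.μ (E ∩ R.obs (t + 1) ⁻¹' V) = ∫⁻ ω in E, I.nextLaw (R.s t ω) V ∂(R.μ) := by
  have := R.prob
  have htrim : (R.μ.restrict (R.obs (t + 1) ⁻¹' V)).trim (R.hist_le t) =
      (R.μ.withDensity fun ω => I.nextLaw (R.s t ω) V).trim (R.hist_le t) := by
    refine @Measure.ext_of_generateFrom_of_cover_subset _ (R.hist t) _ _ (R.histSets t)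
      (Set.range fun j : Fin (t + 1) → Fin K => R.path t (extend j) fun _ => Set.univ) rfl
      (R.isPiSystem_histSets t) ?_ (Set.countable_range _)
      (Set.eq_univ_of_forall fun ω => ⟨_, ⟨_, rfl⟩, R.mem_path_extend t ω⟩)
      (fun _ _ => measure_ne_top _ _) fun E hE => ?_
    · rintro _ ⟨j, rfl⟩
      exact ⟨Set.univ, .univ, extend j, fun _ => Set.univ, fun _ => .univ, by simp⟩
    · have hEm := R.measurableSet_of_mem_histSets hE
      have hEh : MeasurableSet[R.hist t] E := MeasurableSpace.measurableSet_generateFrom hE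
      rw [trim_measurableSet_eq _ hEh, trim_measurableSet_eq _ hEh, Measure.restrict_apply hEm,
        withDensity_apply _ hEm, R.measure_histSets_inter hE hV]
  have hEm := R.hist_le t _ hE
  have htrimE := congrArg (fun m : @Measure R.Ω (R.hist t) => m E) htrim
  rwa [trim_measurableSet_eq _ hE, trim_measurableSet_eq _ hE, Measure.restrict_apply hEm,
    withDensity_apply _ hEm] at htrimE

theorem lintegral_obs_succ {Θ : Set (Params K n)} {D : Set (Vec n)} {σw : ℝ}
    (h : I.Admissible Θ D σw) {β : Type*} [MeasurableSpace β] {t : ℕ} {Z : R.Ω → β}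
    (hZ : Measurable[R.hist t] Z) {F : β × (Fin K × Vec n) → ℝ≥0∞} (hF : Measurable F) :
    ∫⁻ ω, F (Z ω, R.obs (t + 1) ω) ∂(R.μ) = ∫⁻ ω, ∫⁻ z, F (Z ω, z) ∂I.nextLaw (R.s t ω) ∂(R.μ) := by
  have := R.prob
  let κ : Kernel R.Ω (Fin K × Vec n) :=
    ⟨fun ω => I.nextLaw (R.s t ω), (measurable_of_countable I.nextLaw).comp (R.meas_s t)⟩
  have : IsMarkovKernel κ := ⟨fun ω => h.isProbabilityMeasure_nextLaw (R.s t ω)⟩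
  have hZ' : Measurable Z := hZ.mono (R.hist_le t) le_rfl
  have hpair : Measurable fun q : R.Ω × (Fin K × Vec n) => (Z q.1, q.2) := by fun_prop
  have hpair' : Measurable fun ω => (Z ω, R.obs (t + 1) ω) := by fun_prop
  have hlaw : R.μ.map (fun ω => (Z ω, R.obs (t + 1) ω)) =
      (R.μ ⊗ₘ κ).map fun q => (Z q.1, q.2) := by
    have : IsFiniteMeasure (R.μ.map fun ω => (Z ω, R.obs (t + 1) ω)) :=
      Measure.isFiniteMeasure_map _ _
    refine Measure.ext_prod fun {U V} hU hV => ?_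
    rw [Measure.map_apply hpair' (hU.prod hV), Measure.map_apply hpair (hU.prod hV)]
    exact (R.measure_hist_inter (hZ hU) hV).trans
      (Measure.compProd_apply_prod (κ := κ) (hZ' hU) hV).symm
  calc ∫⁻ ω, F (Z ω, R.obs (t + 1) ω) ∂(R.μ)
      = ∫⁻ q, F q ∂(R.μ.map fun ω => (Z ω, R.obs (t + 1) ω)) := (lintegral_map hF hpair').symm
    _ = ∫⁻ q, F (Z q.1, q.2) ∂(R.μ ⊗ₘ κ) := by rw [hlaw, lintegral_map hF hpair]
    _ = _ := Measure.lintegral_compProd (hF.comp hpair)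

end Markov

end Realization

/-! ### Resampling the perturbation of a new pair -/

section Independence

variable {Ω α β γ ι : Type*} {mΩ : MeasurableSpace Ω} {μ : Measure Ω} [MeasurableSpace α]
  [MeasurableSpace β] [MeasurableSpace γ]

theorem indepFun_prodMk_right_of_prodMk_left [IsFiniteMeasure μ] {X : Ω → α} {Y : Ω → β}
    {Z : Ω → γ} (hX : Measurable X) (hY : Measurable Y) (hZ : Measurable Z)
    (hXY : IndepFun X Y μ) (hXYZ : IndepFun (fun ω => (X ω, Y ω)) Z μ) :
    IndepFun X (fun ω => (Y ω, Z ω)) μ := by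
  have hYZ : IndepFun Y Z μ := hXYZ.comp measurable_snd measurable_id
  rw [indepFun_iff_map_prod_eq_prod_map_map hX.aemeasurable (by fun_prop)] at hXY ⊢
  rw [indepFun_iff_map_prod_eq_prod_map_map (by fun_prop) hZ.aemeasurable] at hXYZ hYZ
  rw [hYZ, ← Measure.prodAssoc_prod, ← hXY, ← hXYZ, Measure.map_map (by fun_prop) (by fun_prop)]
  rfl

theorem lintegral_eq_of_indepFun [IsFiniteMeasure μ] {X : Ω → α} {Y : Ω → β}
    (hX : Measurable X) (hY : Measurable Y) (h : IndepFun X Y μ) {F : α × β → ℝ≥0∞}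
    (hF : Measurable F) :
    ∫⁻ ω, F (X ω, Y ω) ∂μ = ∫⁻ ω, ∫⁻ v, F (v, Y ω) ∂(μ.map X) ∂μ := by
  rw [← lintegral_map hF (hX.prodMk hY),
    (indepFun_iff_map_prod_eq_prod_map_map hX.aemeasurable hY.aemeasurable).1 h,
    lintegral_prod_symm _ hF.aemeasurable, lintegral_map hF.lintegral_prod_left' hY]

theorem indepFun_restrict_restrict_compl {X : ι → Ω → α} (hX : ∀ i, Measurable (X i))
    (h : iIndepFun X μ) (S : Set ι) :
    IndepFun (fun ω (i : S) => X i ω) (fun ω (i : (Sᶜ : Set ι)) => X i ω) μ := by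
  have hcomap : ∀ T : Set ι, MeasurableSpace.comap (fun ω (i : T) => X i ω) inferInstance =
      ⨆ i ∈ T, MeasurableSpace.comap (X i) inferInstance := fun T => by
    simp only [MeasurableSpace.pi, MeasurableSpace.comap_iSup, MeasurableSpace.comap_comp,
      iSup_subtype, Function.comp_def]
  rw [IndepFun_iff_Indep, hcomap, hcomap]
  exact indep_iSup_of_disjoint (fun i => (hX i).comap_le) ((iIndepFun_iff_iIndep _ _ _).1 h)
    disjoint_compl_right

end Independence

namespace Realization

variable {K n : ℕ} {I : Model K n}

/-- All perturbation vectors except the one with index `q`, which is replaced by `0`. -/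
def pertExcept {ν : Measure ℝ} (R : Realization I ν) (q : Fin K × ℕ) (ω : R.Ω) :
    Fin K → ℕ → Vec n :=
  fun i k => if (i, k) = q then 0 else R.δ i k ω

theorem measurable_pertExcept {ν : Measure ℝ} (R : Realization I ν) (q : Fin K × ℕ) :
    Measurable (R.pertExcept q) :=
  measurable_pi_lambda _ fun i => measurable_pi_lambda _ fun k =>
    .ite (.const _) measurable_const (R.meas_δ i k)

theorem indepFun_δ_pertExcept {ν : Measure ℝ} (R : Realization I ν) (i : Fin K) (k : ℕ) :
    IndepFun (R.δ i k) (R.pertExcept (i, k)) R.μ := by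
  let S : Set (Fin K × ℕ × Fin n) := {q | (q.1, q.2.1) = (i, k)}
  have hmeas : ∀ q : Fin K × ℕ × Fin n, Measurable fun ω => R.δ q.1 q.2.1 ω q.2.2 := fun q => by
    have := R.meas_δ q.1 q.2.1
    fun_prop
  have hself : Measurable fun (a : S → ℝ) => WithLp.toLp 2 fun l => a ⟨(i, k, l), rfl⟩ := by
    fun_prop
  have hexcept : Measurable fun (a : (Sᶜ : Set _) → ℝ) (i' : Fin K) (k' : ℕ) =>
      if h : (i', k') = (i, k) then 0 else WithLp.toLp 2 fun l => a ⟨(i', k', l), h⟩ := by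
    refine measurable_pi_lambda _ fun i' => measurable_pi_lambda _ fun k' => ?_
    split_ifs <;> fun_prop
  exact (indepFun_restrict_restrict_compl hmeas R.δ_indep S).comp hself hexcept

theorem indepFun_δ_pertExcept_sys {ν : Measure ℝ} (R : Realization I ν) (i : Fin K) (k : ℕ) :
    IndepFun (R.δ i k) (fun ω => (R.pertExcept (i, k) ω, R.sys ω)) R.μ := by
  have := R.prob
  refine indepFun_prodMk_right_of_prodMk_left (R.meas_δ i k) (R.measurable_pertExcept _)
    R.measurable_sys (R.indepFun_δ_pertExcept i k) ?_
  have hmeas : Measurable fun (d : Fin K → ℕ → Vec n) =>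
      (d i k, fun i' k' => if (i', k') = (i, k) then 0 else d i' k') :=
    .prodMk (by fun_prop) <| measurable_pi_lambda _ fun i' => measurable_pi_lambda _ fun k' =>
      .ite (.const _) measurable_const (by fun_prop)
  exact R.indepFun_pert_sys.comp hmeas measurable_id

variable {p : MSPSA K n} (R : Realization I p.ν) (D : Set (Vec n))

theorem map_δ_eq_pertLaw (i : Fin K) (k : ℕ) : R.μ.map (R.δ i k) = p.pertLaw := by
  have := R.prob
  have hδ := R.meas_δ i k
  have hind := R.δ_indep.precomp (g := fun l : Fin n => (i, k, l)) fun l l' h => by simpa using h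
  have hlaw := (iIndepFun_iff_map_fun_eq_pi_map fun l => by fun_prop).1 hind
  simp only [R.δ_law] at hlaw
  rw [MSPSA.pertLaw, ← hlaw, Measure.map_map (by fun_prop) (by fun_prop)]
  rfl

/-- The memory of MSPSA after `t` stages. -/
noncomputable def memory (t : ℕ) (ω : R.Ω) : MSPSA.Memory K n :=
  p.memory D I (fun r => R.s r ω) (fun r => R.w r ω) (R.pert ω) t

variable {D}

theorem measurable_memory (hD : Measurable (euclProj D)) (t : ℕ) : Measurable (R.memory D t) :=
  p.measurable_memory I hD R.measurable_pert t (fun r _ => R.meas_s r) fun r _ => R.meas_w (r + 1)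

theorem measurable_hist_memory (hD : Measurable (euclProj D)) (t : ℕ) :
    Measurable[R.hist t] (R.memory D t) :=
  @MSPSA.measurable_memory _ _ p _ _ (R.hist t) _ I hD _ _ (R.measurable_hist_pert t) t
    (fun _ hr => R.measurable_hist_s hr) fun _ hr => R.measurable_hist_w hr

theorem memory_eq_of_count_lt {t k : ℕ} {i : Fin K} {ω : R.Ω}
    (h : (R.memory D t ω).count i < k ∨ (p.memory D I (fun r => R.s r ω) (fun r => R.w r ω)
      (R.pertExcept (i, k) ω) t).count i < k) :
    R.memory D t ω = p.memory D I (fun r => R.s r ω) (fun r => R.w r ω)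
      (R.pertExcept (i, k) ω) t := by
  have heq : ∀ {m : MSPSA.Memory K n}, m.count i < k →
      ∀ j, ∀ r ≤ m.count j, R.pert ω j r = R.pertExcept (i, k) ω j r := fun hm j r hr => by
    refine (if_neg fun hjr => ?_).symm
    obtain ⟨rfl, rfl⟩ := Prod.mk.inj hjr
    exact hr.not_gt hm
  rcases h with h | h
  · exact p.memory_congr D I _ _ t (heq h)
  · exact (p.memory_congr D I _ _ t fun j r hr => (heq h j r hr).symm).symm

theorem lintegral_δ_of_count (hD : Measurable (euclProj D)) (t : ℕ) (i : Fin K) (k : ℕ)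
    {F : MSPSA.Memory K n × Fin K → Vec n → ℝ≥0∞} (hF : Measurable (Function.uncurry F))
    (hsupp : ∀ m j v, m.count i ≠ k → F (m, j) v = 0) :
    ∫⁻ ω, F (R.memory D t ω, R.s t ω) (R.δ i (k + 1) ω) ∂(R.μ) =
      ∫⁻ ω, ∫⁻ v, F (R.memory D t ω, R.s t ω) v ∂p.pertLaw ∂(R.μ) := by
  have := R.prob
  let past : R.Ω → (Fin K → ℕ → Vec n) × ((ℕ → Fin K) × (ℕ → Vec n)) :=
    fun ω => (R.pertExcept (i, k + 1) ω, R.sys ω)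
  let mem : (Fin K → ℕ → Vec n) × ((ℕ → Fin K) × (ℕ → Vec n)) → MSPSA.Memory K n :=
    fun a => p.memory D I a.2.1 a.2.2 a.1 t
  have hmem : Measurable mem :=
    p.measurable_memory I hD measurable_fst t (fun _ _ => by fun_prop) fun _ _ => by fun_prop
  have hpast : ∀ ω v, F (R.memory D t ω, R.s t ω) v = F (mem (past ω), R.s t ω) v := by
    intro ω v
    by_cases h : (R.memory D t ω).count i = k ∨ (mem (past ω)).count i = k
    · rw [R.memory_eq_of_count_lt (h.imp (fun h => h.trans_lt k.lt_succ_self)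
        fun h => h.trans_lt k.lt_succ_self)]
      rfl
    · rw [hsupp _ _ _ (not_or.1 h).1, hsupp _ _ _ (not_or.1 h).2]
  have hG : Measurable fun a : Vec n × ((Fin K → ℕ → Vec n) × ((ℕ → Fin K) × (ℕ → Vec n))) =>
      F (mem a.2, a.2.2.1 t) a.1 := by
    have hmem' : Measurable fun a : Vec n × ((Fin K → ℕ → Vec n) × ((ℕ → Fin K) × (ℕ → Vec n))) =>
        mem a.2 := hmem.comp measurable_snd
    exact hF.comp ((hmem'.prodMk (by fun_prop)).prodMk measurable_fst)
  simp only [hpast, ← R.map_δ_eq_pertLaw i (k + 1)]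
  exact lintegral_eq_of_indepFun (R.meas_δ i (k + 1))
    ((R.measurable_pertExcept _).prodMk R.measurable_sys) (R.indepFun_δ_pertExcept_sys i (k + 1)) hG

theorem lintegral_fresh_δ (hD : Measurable (euclProj D)) (t : ℕ)
    {F : MSPSA.Memory K n × Fin K → Vec n → ℝ≥0∞} (hF : Measurable (Function.uncurry F)) :
    ∫⁻ ω, F (R.memory D t ω, R.s t ω)
      (R.δ (R.s t ω) ((R.memory D t ω).count (R.s t ω) + 1) ω) ∂(R.μ) =
      ∫⁻ ω, ∫⁻ v, F (R.memory D t ω, R.s t ω) v ∂p.pertLaw ∂(R.μ) := by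
  let key : MSPSA.Memory K n × Fin K → Fin K × ℕ := fun a => (a.2, a.1.count a.2)
  let G : Fin K × ℕ → MSPSA.Memory K n × Fin K → Vec n → ℝ≥0∞ := fun q a v =>
    if q = key a then F a v else 0
  have hFG : ∀ a v, F a v = ∑' q, G q a v := fun a v => (tsum_ite_eq (key a) fun _ => F a v).symm
  have hkey : Measurable key := measurable_snd.prodMk <|
    measurable_apply_of_countable (F := fun i (a : MSPSA.Memory K n × Fin K) => a.1.count i)
      (fun _ => by fun_prop) measurable_snd
  have hG : ∀ q, Measurable (Function.uncurry (G q)) := fun q =>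
    .ite (measurableSet_eq_fun measurable_const (hkey.comp measurable_fst)) hF measurable_const
  have hpair : Measurable fun ω => (R.memory D t ω, R.s t ω) :=
    (R.measurable_memory hD t).prodMk (R.meas_s t)
  have hfresh : ∀ q ω, G q (R.memory D t ω, R.s t ω)
      (R.δ (R.s t ω) ((R.memory D t ω).count (R.s t ω) + 1) ω) =
        G q (R.memory D t ω, R.s t ω) (R.δ q.1 (q.2 + 1) ω) := fun q ω => by
    by_cases h : q = key (R.memory D t ω, R.s t ω)
    · rw [h]
    · simp only [G, if_neg h]
  have hsupp : ∀ q : Fin K × ℕ, ∀ m j v, m.count q.1 ≠ q.2 → G q (m, j) v = 0 :=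
    fun q m j v hm => if_neg fun h => hm (by rw [h])
  have hδ : ∀ q, Measurable fun ω => G q (R.memory D t ω, R.s t ω) (R.δ q.1 (q.2 + 1) ω) :=
    fun q => (hG q).comp (hpair.prodMk (R.meas_δ _ _))
  simp only [hFG, hfresh]
  rw [lintegral_tsum fun q => (hδ q).aemeasurable]
  simp only [R.lintegral_δ_of_count hD t _ _ (hG _) (hsupp _)]
  have hmean : ∀ q, Measurable fun ω => ∫⁻ v, G q (R.memory D t ω, R.s t ω) v ∂p.pertLaw :=
    fun q => by
      have := R.prob
      have : IsProbabilityMeasure p.pertLaw := by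
        rw [← R.map_δ_eq_pertLaw q.1 q.2]
        exact Measure.isProbabilityMeasure_map (R.meas_δ _ _).aemeasurable
      exact (hG q).lintegral_prod_right.comp hpair
  rw [← lintegral_tsum fun q => (hmean q).aemeasurable]
  refine lintegral_congr fun ω => (lintegral_tsum fun q => ?_).symm
  exact ((hG q).comp measurable_prodMk_left).aemeasurable

end Realization

/-! ### Cost-to-go functions -/

theorem enorm_add_sq_le {E : Type*} [SeminormedAddCommGroup E] (x y : E) :
    ‖x + y‖ₑ ^ 2 ≤ 2 * (‖x‖ₑ ^ 2 + ‖y‖ₑ ^ 2) := by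
  have h : ‖x + y‖ ^ 2 ≤ 2 * (‖x‖ ^ 2 + ‖y‖ ^ 2) :=
    (pow_le_pow_left₀ (norm_nonneg _) (norm_add_le x y) 2).trans add_sq_le
  simpa [ENNReal.ofReal_mul, ENNReal.ofReal_add, ENNReal.ofReal_pow] using
    ENNReal.ofReal_le_ofReal h

namespace MSPSA

section Potential

variable {K n : ℕ} (p : MSPSA K n) (D : Set (Vec n)) (I : Model K n) (ξ : ℝ)
  (V : Fin K → ℕ → Vec n → ℝ≥0∞)

/-- A bound on `2 ‖c v‖ ^ 2` when `c` is the perturbation gain and `v` has entries at most `ξ`. -/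
noncomputable def pertBound (i : Fin K) (k : ℕ) : ℝ≥0∞ :=
  ENNReal.ofReal (2 * (p.pertGain i k ^ 2 * (n * ξ ^ 2)))

/-- `V i k x` bounds the mean cost of all visits to state `i` within a horizon of `T` stages that
follow the first `k` pairs, when the estimate is then `x`. The squared distance of an input to the
optimum is split into the contributions of the estimate and of the perturbation. -/
structure IsCostToGo (T : ℕ) : Prop where
  measurable : ∀ i k, Measurable (V i k)
  bellman_le : ∀ i, ∀ k < T, ∀ x ∈ D,
    4 * ‖x - I.optInput i‖ₑ ^ 2 + 2 * p.pertBound ξ i (k + 1) +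
      ∫⁻ v, p.pairCost D I (V i (k + 1)) i (k + 1) x v ∂p.pertLaw ≤ V i k x

/-- The bound on the mean cost of the visits to state `i` that are still to come which a cost-to-go
function `V` gives in the middle of a pair of searches as well as between two pairs. -/
noncomputable def potential (m : Memory K n) (δ : Fin K → ℕ → Vec n) (i : Fin K) : ℝ≥0∞ :=
  if m.flag i then
    2 * ‖m.est i - I.optInput i‖ₑ ^ 2 + p.pertBound ξ i (m.count i) +
      p.halfPairCost D I (V i (m.count i)) i (m.count i) (m.est i) (m.dPlus i) (δ i (m.count i))
  else V i (m.count i) (m.est i)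

/-- The mean potential of state `i` after a stage that starts in state `i`. -/
noncomputable def potentialAfter (m : Memory K n) (δ : Fin K → ℕ → Vec n) (i : Fin K) : ℝ≥0∞ :=
  ∫⁻ z, p.potential D I ξ V (p.update D m δ i (I.output z.1 (p.input m δ i) z.2)) δ i ∂I.nextLaw i

/-- The bound on the mean cost of the visits to state `a.2` that `V` gives at the start of a pair of
searches with perturbation `v`; it is `0` in the middle of a pair. -/
noncomputable def freshPairCost (a : Memory K n × Fin K) (v : Vec n) : ℝ≥0∞ :=
  if a.1.flag a.2 then 0
  else 4 * ‖a.1.est a.2 - I.optInput a.2‖ₑ ^ 2 + 2 * p.pertBound ξ a.2 (a.1.count a.2 + 1) +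
    p.pairCost D I (V a.2 (a.1.count a.2 + 1)) a.2 (a.1.count a.2 + 1) (a.1.est a.2) v

variable {p D I ξ V} {Θ : Set (Params K n)} {σw : ℝ}

theorem two_mul_enorm_smul_sq_le_pertBound (i : Fin K) (k : ℕ) {v : Vec n} (hv : ∀ l, |v l| ≤ ξ) :
    2 * ‖p.pertGain i k • v‖ₑ ^ 2 ≤ p.pertBound ξ i k := by
  have h : 2 * ‖p.pertGain i k • v‖ ^ 2 ≤ 2 * (p.pertGain i k ^ 2 * (n * ξ ^ 2)) := by
    rw [norm_smul, mul_pow, Real.norm_eq_abs, sq_abs]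
    gcongr
    simpa only [Fintype.card_fin] using norm_sq_le_of_abs_le hv
  refine le_of_eq_of_le ?_ (ENNReal.ofReal_le_ofReal h)
  rw [ENNReal.ofReal_mul zero_le_two, ENNReal.ofReal_pow (norm_nonneg _), ofReal_norm,
    ENNReal.ofReal_ofNat]

theorem enorm_input_sub_optInput_sq_le {δ : Fin K → ℕ → Vec n} (hδ : ∀ i k l, |δ i k l| ≤ ξ)
    (m : Memory K n) (i : Fin K) :
    ‖p.input m δ i - I.optInput i‖ₑ ^ 2 ≤ 2 * ‖m.est i - I.optInput i‖ₑ ^ 2 +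
      p.pertBound ξ i (if m.flag i then m.count i else m.count i + 1) := by
  have hsplit : ∀ k, ∀ u : Vec n, ‖u‖ₑ = ‖p.pertGain i k • δ i k‖ₑ →
      ‖m.est i - I.optInput i + u‖ₑ ^ 2 ≤
        2 * ‖m.est i - I.optInput i‖ₑ ^ 2 + p.pertBound ξ i k := fun k u hu => by
    refine (enorm_add_sq_le _ u).trans ?_
    rw [hu, mul_add]
    gcongr
    exact two_mul_enorm_smul_sq_le_pertBound i k (hδ i k)
  cases hf : m.flag i
  · rw [p.input_of_flag_false hf, add_sub_right_comm]
    exact hsplit _ _ rfl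
  · rw [p.input_of_flag_true hf, sub_right_comm, sub_eq_add_neg (m.est i - I.optInput i)]
    exact hsplit _ _ (enorm_neg _)

theorem measurable_potential (h : I.Admissible Θ D σw) (hD : Measurable (euclProj D))
    (hV : ∀ i k, Measurable (V i k)) {α : Type*} [MeasurableSpace α] {m : α → Memory K n}
    {δ : α → Fin K → ℕ → Vec n} (hm : Measurable m) (hδ : Measurable δ) (i : Fin K) :
    Measurable fun a => p.potential D I ξ V (m a) (δ a) i := by
  have hcount : Measurable fun a => (m a).count i := by fun_prop
  have hhalf : Measurable fun a => p.halfPairCost D I (V i ((m a).count i)) i ((m a).count i)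
      ((m a).est i) ((m a).dPlus i) (δ a i ((m a).count i)) :=
    measurable_apply_of_countable (F := fun k a => p.halfPairCost D I (V i k) i k ((m a).est i)
      ((m a).dPlus i) (δ a i k)) (fun k => p.measurable_halfPairCost h hD (hV i k) i k
        (by fun_prop) (by fun_prop) (by fun_prop)) hcount
  have hbound := (measurable_of_countable (p.pertBound ξ i)).comp hcount
  unfold potential
  refine Measurable.ite ?_ (.add (.add (by fun_prop) hbound) hhalf) ?_
  · exact (show Measurable fun a => (m a).flag i by fun_prop) (measurableSet_singleton true)
  · exact measurable_apply_of_countable (F := fun k a => V i k ((m a).est i))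
      (fun k => (hV i k).comp (by fun_prop)) hcount

theorem measurable_freshPairCost (h : I.Admissible Θ D σw) (hD : Measurable (euclProj D))
    (hV : ∀ i k, Measurable (V i k)) :
    Measurable (Function.uncurry (p.freshPairCost D I ξ V)) := by
  suffices hi : ∀ i, Measurable fun a : (Memory K n × Fin K) × Vec n =>
      p.freshPairCost D I ξ V (a.1.1, i) a.2 from
    measurable_apply_of_countable
      (F := fun i (a : (Memory K n × Fin K) × Vec n) => p.freshPairCost D I ξ V (a.1.1, i) a.2)
      hi measurable_fst.snd
  intro i
  have hcount : Measurable fun a : (Memory K n × Fin K) × Vec n => a.1.1.count i := by fun_prop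
  have hest : Measurable fun a : (Memory K n × Fin K) × Vec n =>
      4 * ‖a.1.1.est i - I.optInput i‖ₑ ^ 2 := by fun_prop
  have hbound : Measurable fun a : (Memory K n × Fin K) × Vec n =>
      2 * p.pertBound ξ i (a.1.1.count i + 1) :=
    (measurable_of_countable fun k => 2 * p.pertBound ξ i (k + 1)).comp hcount
  have hpair : Measurable fun a : (Memory K n × Fin K) × Vec n =>
      p.pairCost D I (V i (a.1.1.count i + 1)) i (a.1.1.count i + 1) (a.1.1.est i) a.2 :=
    measurable_apply_of_countable (F := fun k (a : (Memory K n × Fin K) × Vec n) =>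
      p.pairCost D I (V i (k + 1)) i (k + 1) (a.1.1.est i) a.2)
      (fun k => p.measurable_pairCost h hD (hV i (k + 1)) i (k + 1) (by fun_prop) (by fun_prop))
      hcount
  have hflag : Measurable fun a : (Memory K n × Fin K) × Vec n => a.1.1.flag i := by fun_prop
  exact .ite (hflag (measurableSet_singleton true)) measurable_const ((hest.add hbound).add hpair)

theorem potential_update_of_ne (m : Memory K n) (δ : Fin K → ℕ → Vec n) {i j : Fin K}
    (hj : j ≠ i) (y : Vec n) :
    p.potential D I ξ V (p.update D m δ i y) δ j = p.potential D I ξ V m δ j := by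
  cases hf : m.flag i
  · rw [p.update_of_flag_false D hf]
    simp only [potential, Function.update_of_ne hj]
  · rw [p.update_of_flag_true D hf]
    simp only [potential, Function.update_of_ne hj]

theorem potentialAfter_of_flag_true {m : Memory K n} {i : Fin K} (hf : m.flag i = true)
    (δ : Fin K → ℕ → Vec n) :
    p.potentialAfter D I ξ V m δ i = p.halfPairCost D I (V i (m.count i)) i (m.count i) (m.est i)
      (m.dPlus i) (δ i (m.count i)) := by
  refine lintegral_congr fun z => ?_
  simp only [p.update_of_flag_true D hf, p.input_of_flag_true hf, potential, Function.update_self,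
    Bool.false_eq_true, if_false]
  rfl

theorem potentialAfter_of_flag_false (h : I.Admissible Θ D σw) {m : Memory K n} {i : Fin K}
    (hf : m.flag i = false) (δ : Fin K → ℕ → Vec n) :
    p.potentialAfter D I ξ V m δ i =
      2 * ‖m.est i - I.optInput i‖ₑ ^ 2 + p.pertBound ξ i (m.count i + 1) +
        p.pairCost D I (V i (m.count i + 1)) i (m.count i + 1) (m.est i)
          (δ i (m.count i + 1)) := by
  have := h.isProbabilityMeasure_nextLaw i
  simp only [potentialAfter, p.update_of_flag_false D hf, p.input_of_flag_false hf, potential,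
    Function.update_self, if_true]
  rw [lintegral_add_left measurable_const, lintegral_const, measure_univ, mul_one]
  rfl

theorem enorm_input_add_potentialAfter_le (h : I.Admissible Θ D σw) {δ : Fin K → ℕ → Vec n}
    (hδ : ∀ i k l, |δ i k l| ≤ ξ) (m : Memory K n) (i : Fin K) :
    ‖p.input m δ i - I.optInput i‖ₑ ^ 2 + p.potentialAfter D I ξ V m δ i ≤
      (if m.flag i then p.potential D I ξ V m δ i else 0) +
        p.freshPairCost D I ξ V (m, i) (δ i (m.count i + 1)) := by
  have hinput := enorm_input_sub_optInput_sq_le (p := p) (I := I) hδ m i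
  cases hf : m.flag i
  · rw [potentialAfter_of_flag_false h hf]
    simp only [hf, freshPairCost, Bool.false_eq_true, if_false, zero_add] at hinput ⊢
    refine (add_le_add_left hinput _).trans_eq ?_
    ring
  · rw [potentialAfter_of_flag_true hf]
    simp only [hf, freshPairCost, potential, if_true, add_zero] at hinput ⊢
    gcongr

theorem IsCostToGo.lintegral_freshPairCost_le {T : ℕ} (hV : p.IsCostToGo D I ξ V T)
    [IsProbabilityMeasure (p.pertLaw (n := n))] (δ : Fin K → ℕ → Vec n) {m : Memory K n} {i : Fin K}
    (hcount : m.count i < T) (hest : m.est i ∈ D) :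
    (if m.flag i then p.potential D I ξ V m δ i else 0) +
      ∫⁻ v, p.freshPairCost D I ξ V (m, i) v ∂p.pertLaw ≤ p.potential D I ξ V m δ i := by
  cases hf : m.flag i
  · simp only [freshPairCost, potential, hf, Bool.false_eq_true, if_false, zero_add]
    rw [lintegral_add_left measurable_const, lintegral_const, measure_univ, mul_one]
    exact hV.bellman_le i _ hcount _ hest
  · simp only [freshPairCost, hf, if_true, lintegral_zero, add_zero, le_refl]

end Potential

end MSPSA

namespace Realization

section Potential

variable {K n : ℕ} {p : MSPSA K n} {I : Model K n} (R : Realization I p.ν) {Θ : Set (Params K n)}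
  {D : Set (Vec n)} {σw ξ₁ ξ₂ : ℝ} {V : Fin K → ℕ → Vec n → ℝ≥0∞}

theorem ae_abs_pert_le (hp : p.Valid D ξ₁ ξ₂) :
    ∀ᵐ ω ∂(R.μ), ∀ i k l, |R.pert ω i k l| ≤ ξ₁ := by
  simp only [ae_all_iff]
  intro i k l
  have hδ := R.meas_δ i k
  have hν := hp.ν_bdd
  rw [← R.δ_law i k l] at hν
  exact ae_of_ae_map (by fun_prop) hν

theorem measurable_input (hD : Measurable (euclProj D)) (t : ℕ) : Measurable (R.input D t) :=
  p.measurable_input (R.measurable_memory hD t) R.measurable_pert (R.meas_s t)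

theorem measurable_enorm_input_sub_optInput_sq (hD : Measurable (euclProj D)) (t : ℕ) :
    Measurable fun ω => ‖R.input D t ω - I.optInput (R.s t ω)‖ₑ ^ 2 := by
  have hinput := R.measurable_input hD t
  have hopt := (measurable_of_countable I.optInput).comp (R.meas_s t)
  exact ((hinput.sub hopt).enorm).pow_const 2

theorem measurable_potential_memory (h : I.Admissible Θ D σw) (hD : Measurable (euclProj D))
    (hV : ∀ i k, Measurable (V i k)) (t : ℕ) (i : Fin K) :
    Measurable fun ω => p.potential D I ξ₁ V (R.memory D t ω) (R.pert ω) i :=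
  MSPSA.measurable_potential h hD hV (R.measurable_memory hD t) R.measurable_pert i

theorem measurable_potential_memory_s (h : I.Admissible Θ D σw) (hD : Measurable (euclProj D))
    (hV : ∀ i k, Measurable (V i k)) (t r : ℕ) :
    Measurable fun ω => p.potential D I ξ₁ V (R.memory D t ω) (R.pert ω) (R.s r ω) :=
  measurable_apply_of_countable
    (F := fun i ω => p.potential D I ξ₁ V (R.memory D t ω) (R.pert ω) i)
    (fun i => R.measurable_potential_memory h hD hV t i) (R.meas_s r)

theorem lintegral_enorm_input_add_potentialAfter_le (hp : p.Valid D ξ₁ ξ₂)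
    (h : I.Admissible Θ D σw) (hDc : IsClosed D) (hD : Measurable (euclProj D)) {T t : ℕ}
    (ht : t < T) (hV : p.IsCostToGo D I ξ₁ V T) :
    ∫⁻ ω, (‖R.input D t ω - I.optInput (R.s t ω)‖ₑ ^ 2 +
        p.potentialAfter D I ξ₁ V (R.memory D t ω) (R.pert ω) (R.s t ω)) ∂(R.μ) ≤
      ∫⁻ ω, p.potential D I ξ₁ V (R.memory D t ω) (R.pert ω) (R.s t ω) ∂(R.μ) := by
  have := hp.isProbabilityMeasure_pertLaw (n := n)
  let midPair : R.Ω → ℝ≥0∞ := fun ω => if (R.memory D t ω).flag (R.s t ω) then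
    p.potential D I ξ₁ V (R.memory D t ω) (R.pert ω) (R.s t ω) else 0
  have hmid : Measurable midPair := by
    have hm := R.measurable_memory hD t
    have hflag : Measurable fun ω => (R.memory D t ω).flag (R.s t ω) :=
      measurable_apply_of_countable (F := fun i ω => (R.memory D t ω).flag i)
        (fun i => by fun_prop) (R.meas_s t)
    exact .ite (hflag (measurableSet_singleton true))
      (R.measurable_potential_memory_s h hD hV.measurable t t) measurable_const
  have hfresh := MSPSA.measurable_freshPairCost (p := p) (ξ := ξ₁) h hD hV.measurable
  calc _ ≤ ∫⁻ ω, (midPair ω + p.freshPairCost D I ξ₁ V (R.memory D t ω, R.s t ω)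
          (R.δ (R.s t ω) ((R.memory D t ω).count (R.s t ω) + 1) ω)) ∂(R.μ) :=
        lintegral_mono_ae <| (R.ae_abs_pert_le hp).mono fun ω hω =>
          MSPSA.enorm_input_add_potentialAfter_le h hω _ _
    _ = ∫⁻ ω, (midPair ω + ∫⁻ v, p.freshPairCost D I ξ₁ V (R.memory D t ω, R.s t ω) v
          ∂p.pertLaw) ∂(R.μ) := by
        rw [lintegral_add_left hmid, lintegral_add_left hmid, R.lintegral_fresh_δ hD t hfresh]
    _ ≤ _ := lintegral_mono fun ω => hV.lintegral_freshPairCost_le _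
        ((p.memory_count_le D I _ _ _ t _).trans_lt ht)
        (p.memory_est_mem I _ _ hDc hp.xInit_mem _ t _)

theorem lintegral_potential_succ (h : I.Admissible Θ D σw) (hD : Measurable (euclProj D))
    (hV : ∀ i k, Measurable (V i k)) (t : ℕ) :
    ∫⁻ ω, p.potential D I ξ₁ V (R.memory D (t + 1) ω) (R.pert ω) (R.s t ω) ∂(R.μ) =
      ∫⁻ ω, p.potentialAfter D I ξ₁ V (R.memory D t ω) (R.pert ω) (R.s t ω) ∂(R.μ) := by
  let F : (MSPSA.Memory K n × (Fin K → ℕ → Vec n) × Fin K) × (Fin K × Vec n) → ℝ≥0∞ := fun a =>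
    p.potential D I ξ₁ V (p.update D a.1.1 a.1.2.1 a.1.2.2
      (I.output a.2.1 (p.input a.1.1 a.1.2.1 a.1.2.2) a.2.2)) a.1.2.1 a.1.2.2
  have hF : Measurable F := by
    have hinput := p.measurable_input (α := (MSPSA.Memory K n × (Fin K → ℕ → Vec n) × Fin K) ×
      (Fin K × Vec n)) (m := fun a => a.1.1) (δ := fun a => a.1.2.1) (i := fun a => a.1.2.2)
      (by fun_prop) (by fun_prop) (by fun_prop)
    have hupdate := p.measurable_update hD measurable_fst.fst measurable_fst.snd.fst
      measurable_fst.snd.snd (I.measurable_output measurable_snd.fst hinput measurable_snd.snd)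
    exact measurable_apply_of_countable
      (fun i => MSPSA.measurable_potential h hD hV hupdate measurable_fst.snd.fst i)
      measurable_fst.snd.snd
  have hZ : Measurable[R.hist t] fun ω => (R.memory D t ω, R.pert ω, R.s t ω) :=
    (R.measurable_hist_memory hD t).prodMk
      ((R.measurable_hist_pert t).prodMk (R.measurable_hist_s le_rfl))
  exact R.lintegral_obs_succ h hZ hF

theorem lintegral_enorm_input_add_sum_potential_le (hp : p.Valid D ξ₁ ξ₂)
    (h : I.Admissible Θ D σw) (hDc : IsClosed D) (hD : Measurable (euclProj D)) {T t : ℕ}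
    (ht : t < T) (hV : p.IsCostToGo D I ξ₁ V T) :
    ∫⁻ ω, ‖R.input D t ω - I.optInput (R.s t ω)‖ₑ ^ 2 ∂(R.μ) +
        ∫⁻ ω, ∑ i, p.potential D I ξ₁ V (R.memory D (t + 1) ω) (R.pert ω) i ∂(R.μ) ≤
      ∫⁻ ω, ∑ i, p.potential D I ξ₁ V (R.memory D t ω) (R.pert ω) i ∂(R.μ) := by
  let others : R.Ω → ℝ≥0∞ := fun ω => ∑ j ∈ Finset.univ.erase (R.s t ω),
    p.potential D I ξ₁ V (R.memory D t ω) (R.pert ω) j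
  have hsplit : ∀ ω, ∑ i, p.potential D I ξ₁ V (R.memory D t ω) (R.pert ω) i =
      p.potential D I ξ₁ V (R.memory D t ω) (R.pert ω) (R.s t ω) + others ω := fun ω =>
    (Finset.add_sum_erase _ _ (Finset.mem_univ (R.s t ω))).symm
  have hsplit_succ : ∀ ω, ∑ i, p.potential D I ξ₁ V (R.memory D (t + 1) ω) (R.pert ω) i =
      p.potential D I ξ₁ V (R.memory D (t + 1) ω) (R.pert ω) (R.s t ω) + others ω := fun ω => by
    rw [← Finset.add_sum_erase _ _ (Finset.mem_univ (R.s t ω))]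
    congr 1
    exact Finset.sum_congr rfl fun j hj =>
      MSPSA.potential_update_of_ne _ _ (Finset.ne_of_mem_erase hj) _
  simp only [hsplit, hsplit_succ]
  rw [lintegral_add_left (R.measurable_potential_memory_s h hD hV.measurable _ _),
    lintegral_add_left (R.measurable_potential_memory_s h hD hV.measurable _ _), ← add_assoc,
    R.lintegral_potential_succ h hD hV.measurable,
    ← lintegral_add_left (R.measurable_enorm_input_sub_optInput_sq hD t)]
  exact add_le_add (R.lintegral_enorm_input_add_potentialAfter_le hp h hDc hD ht hV) le_rfl

theorem inputMSE_le_of_isCostToGo (hp : p.Valid D ξ₁ ξ₂) (h : I.Admissible Θ D σw)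
    (hDc : IsClosed D) (hD : Measurable (euclProj D)) {T : ℕ} (hV : p.IsCostToGo D I ξ₁ V T) :
    R.inputMSE D T ≤ ∑ i, V i 0 (p.xInit i) := by
  have := R.prob
  have htelescope : ∀ t ≤ T, ∑ r ∈ Finset.range t,
      ∫⁻ ω, ‖R.input D r ω - I.optInput (R.s r ω)‖ₑ ^ 2 ∂(R.μ) +
      ∫⁻ ω, ∑ i, p.potential D I ξ₁ V (R.memory D t ω) (R.pert ω) i ∂(R.μ) ≤
      ∑ i, V i 0 (p.xInit i) := by
    intro t ht
    induction t with
    | zero =>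
      have hinit : ∀ ω, ∑ i, p.potential D I ξ₁ V (R.memory D 0 ω) (R.pert ω) i =
        ∑ i, V i 0 (p.xInit i) := fun ω => rfl
      simp [hinit]
    | succ t ih =>
      refine le_trans ?_ (ih (by lia))
      rw [Finset.sum_range_succ, add_assoc]
      gcongr
      exact R.lintegral_enorm_input_add_sum_potential_le hp h hDc hD ht hV
  rw [inputMSE, lintegral_finsetSum _ fun t _ => R.measurable_enorm_input_sub_optInput_sq hD t]
  exact le_self_add.trans (htelescope T le_rfl)

end Potential

end Realization

/-- `α k * e + ρ k` is the cost-to-go of the recursion `e ↦ q k * e + β k` with running cost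
`c k * e + d k`. -/
theorem exists_affine_costToGo {R : Type*} [CommSemiring R] [PartialOrder R]
    [CanonicallyOrderedAdd R] (T : ℕ) (c d q β u : ℕ → R)
    (hu : ∀ k < T, q k * u k + β k ≤ u (k + 1)) :
    ∃ α ρ : ℕ → R, (∀ k < T, α k = c k + α (k + 1) * q k) ∧
      (∀ k < T, ρ k = d k + α (k + 1) * β k + ρ (k + 1)) ∧
      α 0 * u 0 + ρ 0 ≤ ∑ k ∈ Finset.range T, (c k * u k + d k) := by
  induction T generalizing c d q β u with
  | zero => exact ⟨0, 0, by simp⟩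
  | succ T ih =>
    obtain ⟨α, ρ, hα, hρ, hsum⟩ := ih (fun k => c (k + 1)) (fun k => d (k + 1))
      (fun k => q (k + 1)) (fun k => β (k + 1)) (fun k => u (k + 1))
      fun k hk => hu (k + 1) (by lia)
    refine ⟨fun k => Nat.casesOn k (c 0 + α 0 * q 0) α,
      fun k => Nat.casesOn k (d 0 + α 0 * β 0 + ρ 0) ρ, ?_, ?_, ?_⟩
    · rintro (_ | k) hk
      exacts [rfl, hα k (by lia)]
    · rintro (_ | k) hk
      exacts [rfl, hρ k (by lia)]
    · calc (c 0 + α 0 * q 0) * u 0 + (d 0 + α 0 * β 0 + ρ 0)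
        _ = α 0 * (q 0 * u 0 + β 0) + ρ 0 + (c 0 * u 0 + d 0) := by ring
        _ ≤ α 0 * u 1 + ρ 0 + (c 0 * u 0 + d 0) := by
          gcongr
          exact hu 0 T.succ_pos
        _ ≤ _ := by
          rw [Finset.sum_range_succ']
          gcongr

theorem sum_one_div_sqrt_le (T : ℕ) : ∑ k ∈ Finset.range T, 1 / √(k + 1 : ℝ) ≤ 2 * √T := by
  have hdiff : ∀ k : ℕ, 1 / √(k + 1 : ℝ) ≤ 2 * √(k + 1 : ℕ) - 2 * √k := fun k => by
    have hk : (0 : ℝ) ≤ k := k.cast_nonneg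
    rw [div_le_iff₀ (by positivity), Nat.cast_add_one]
    linarith [two_mul_le_add_sq √(k + 1 : ℝ) √k, Real.sq_sqrt hk,
      Real.mul_self_sqrt (add_nonneg hk zero_le_one), Real.sq_sqrt (add_nonneg hk zero_le_one)]
  refine (Finset.sum_le_sum fun k _ => hdiff k).trans_eq ?_
  rw [Finset.sum_range_sub fun k : ℕ => 2 * √(k : ℝ)]
  simp

theorem one_sub_mul_div_sqrt_add_le {m B b : ℝ} (hm : 1 ≤ m) (hb : 2 * b ≤ B) (hB : 0 ≤ B) :
    (1 - 1 / m) * (B / √m) + b * √m / m ^ 2 ≤ B / √(m + 1) := by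
  have hm₀ : 0 < m := one_pos.trans_le hm
  have hsqrt : √(m + 1) ≤ √m * (1 + 1 / (2 * m)) := by
    rw [Real.sqrt_le_left (by positivity), mul_pow, Real.sq_sqrt hm₀.le]
    have : m * (1 + 1 / (2 * m)) ^ 2 = m + 1 + 1 / (4 * m) := by field_simp; ring
    rw [this]
    exact le_add_of_nonneg_right (by positivity)
  calc (1 - 1 / m) * (B / √m) + b * √m / m ^ 2
    _ = B / √m * (1 - 1 / m) + 2 * b / √m * (1 / (2 * m)) := by
      field_simp
      rw [Real.sq_sqrt hm₀.le]
      ring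
    _ ≤ B / √m * (1 - 1 / m) + B / √m * (1 / (2 * m)) := by gcongr
    _ = B / √m * (1 - 1 / (2 * m)) := by ring
    _ ≤ B / √m * (1 / (1 + 1 / (2 * m))) := by
      gcongr
      rw [le_div_iff₀ (by positivity)]
      linarith [sq_nonneg (1 / (2 * m))]
    _ = B / (√m * (1 + 1 / (2 * m))) := by rw [div_mul_div_comm, mul_one]
    _ ≤ B / √(m + 1) := by gcongr

namespace MSPSA

variable {K n : ℕ} {p : MSPSA K n} {I : Model K n} {Θ : Set (Params K n)} {D : Set (Vec n)}
  {σw : ℝ}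

theorem pairCost_mul_add (h : I.Admissible Θ D σw) (hD : Measurable (euclProj D))
    {F : Vec n → ℝ≥0∞} (hF : Measurable F) (a b : ℝ≥0∞) (i : Fin K) (k : ℕ) (x v : Vec n) :
    p.pairCost D I (fun y => a * F y + b) i k x v = a * p.pairCost D I F i k x v + b := by
  have := h.isProbabilityMeasure_nextLaw i
  have hhalf : ∀ d, p.halfPairCost D I (fun y => a * F y + b) i k x d v =
      a * p.halfPairCost D I F i k x d v + b := fun d => by
    have hnext : Measurable fun z => F (p.newEst D i k x d
        (I.obsCost (x - p.pertGain i k • v) z) v) := by fun_prop (disch := assumption)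
    rw [halfPairCost, lintegral_add_right _ measurable_const, lintegral_const_mul _ hnext,
      lintegral_const, measure_univ, mul_one, halfPairCost]
  have hmeas := p.measurable_halfPairCost h hD hF i k (x := fun _ => x) (v := fun _ => v)
    (d := I.obsCost (x + p.pertGain i k • v)) (by fun_prop) (by fun_prop) (by fun_prop)
  simp only [pairCost, hhalf]
  rw [lintegral_add_right _ measurable_const, lintegral_const_mul _ hmeas, lintegral_const,
    measure_univ, mul_one]

theorem exists_isCostToGo [IsProbabilityMeasure (p.pertLaw (n := n))] (h : I.Admissible Θ D σw)
    (hD : Measurable (euclProj D)) (ξ : ℝ) {q β u : Fin K → ℕ → ℝ≥0∞}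
    (hpair : ∀ i k, ∀ x ∈ D, ∫⁻ v, p.pairCost D I (fun y => ‖y - I.optInput i‖ₑ ^ 2) i (k + 1) x v
      ∂p.pertLaw ≤ q i k * ‖x - I.optInput i‖ₑ ^ 2 + β i k)
    (hu₀ : ∀ i, ‖p.xInit i - I.optInput i‖ₑ ^ 2 ≤ u i 0)
    (hu : ∀ i k, q i k * u i k + β i k ≤ u i (k + 1)) (T : ℕ) :
    ∃ V, p.IsCostToGo D I ξ V T ∧ ∀ i, V i 0 (p.xInit i) ≤
      ∑ k ∈ Finset.range T, (4 * u i k + 2 * p.pertBound ξ i (k + 1)) := by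
  choose α ρ hα hρ hsum using fun i => exists_affine_costToGo T (fun _ => 4)
    (fun k => 2 * p.pertBound ξ i (k + 1)) (q i) (β i) (u i) fun k _ => hu i k
  have herr : ∀ i, Measurable fun y : Vec n => ‖y - I.optInput i‖ₑ ^ 2 := fun i => by fun_prop
  refine ⟨fun i k y => α i k * ‖y - I.optInput i‖ₑ ^ 2 + ρ i k,
    ⟨fun i k => by fun_prop, fun i k hk x hx => ?_⟩, fun i => (hsum i).trans' ?_⟩
  · have hmeas := p.measurable_pairCost h hD (herr i) i (k + 1) (x := fun _ => x) (v := fun v => v)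
      measurable_const measurable_id'
    calc 4 * ‖x - I.optInput i‖ₑ ^ 2 + 2 * p.pertBound ξ i (k + 1) +
          ∫⁻ v, p.pairCost D I (fun y => α i (k + 1) * ‖y - I.optInput i‖ₑ ^ 2 + ρ i (k + 1))
            i (k + 1) x v ∂p.pertLaw
      _ = 4 * ‖x - I.optInput i‖ₑ ^ 2 + 2 * p.pertBound ξ i (k + 1) +
          (α i (k + 1) * ∫⁻ v, p.pairCost D I (fun y => ‖y - I.optInput i‖ₑ ^ 2) i (k + 1) x v
            ∂p.pertLaw + ρ i (k + 1)) := by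
        simp only [pairCost_mul_add h hD (herr i)]
        rw [lintegral_add_right _ measurable_const, lintegral_const_mul _ hmeas, lintegral_const,
          measure_univ, mul_one]
      _ ≤ 4 * ‖x - I.optInput i‖ₑ ^ 2 + 2 * p.pertBound ξ i (k + 1) +
          (α i (k + 1) * (q i k * ‖x - I.optInput i‖ₑ ^ 2 + β i k) + ρ i (k + 1)) := by
        gcongr
        exact hpair i k x hx
      _ = α i k * ‖x - I.optInput i‖ₑ ^ 2 + ρ i k := by
        rw [hα i k hk, hρ i k hk]
        ring
  · refine add_le_add ?_ le_rfl
    gcongr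
    exact hu₀ i

end MSPSA

/-! ### The error rate -/

theorem rpow_one_div_four_sq {x : ℝ} (hx : 0 ≤ x) : (x ^ (1 / 4 : ℝ)) ^ 2 = √x := by
  rw [← Real.rpow_natCast, ← Real.rpow_mul hx, Real.sqrt_eq_rpow]
  norm_num

theorem one_sub_one_div_nonneg {m : ℝ} (hm : 1 ≤ m) : 0 ≤ 1 - 1 / m :=
  sub_nonneg.2 ((div_le_one (one_pos.trans_le hm)).2 hm)

namespace MSPSA

section Gains

variable {K n : ℕ} {p : MSPSA K n} {D : Set (Vec n)} {ξ₁ ξ₂ : ℝ}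

theorem Valid.pertGain_le (hp : p.Valid D ξ₁ ξ₂) (i : Fin K) (k : ℕ) :
    p.pertGain i k ≤ p.γ' i := by
  rw [pertGain]
  rcases (p.N' i + k).eq_zero_or_pos with hk | hk
  · rw [← Nat.cast_add, hk, Nat.cast_zero, Real.zero_rpow (by norm_num), div_zero]
    exact (hp.γ'_pos i).le
  · exact div_le_self (hp.γ'_pos i).le (Real.one_le_rpow (by exact_mod_cast hk) (by norm_num))

theorem pertGain_sq (i : Fin K) (k : ℕ) : p.pertGain i k ^ 2 = p.γ' i ^ 2 / √(p.N' i + k) := by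
  rw [pertGain, div_pow, rpow_one_div_four_sq (by positivity)]

theorem pertGain_succ_sq_le (i : Fin K) (k : ℕ) :
    p.pertGain i (k + 1) ^ 2 ≤ p.γ' i ^ 2 * (1 / √(k + 1 : ℝ)) := by
  rw [pertGain_sq, mul_one_div, Nat.cast_add_one]
  exact div_le_div_of_nonneg_left (sq_nonneg _) (by positivity)
    (Real.sqrt_le_sqrt (le_add_of_nonneg_left (by positivity)))

theorem stepGain_div_pertGain_sq_le (i : Fin K) (k : ℕ) :
    (p.stepGain i (k + 1) / p.pertGain i (k + 1)) ^ 2 ≤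
      p.γ i ^ 2 / p.γ' i ^ 2 * √(p.N' i + 1) * √(p.N i + k + 1) / (p.N i + k + 1) ^ 2 := by
  have hN : (0 : ℝ) ≤ p.N i := (p.N i).cast_nonneg
  have hN' : (0 : ℝ) ≤ p.N' i := (p.N' i).cast_nonneg
  have hk : (0 : ℝ) ≤ k := k.cast_nonneg
  calc (p.stepGain i (k + 1) / p.pertGain i (k + 1)) ^ 2
    _ = p.γ i ^ 2 / p.γ' i ^ 2 * √(p.N' i + (k + 1)) / (p.N i + k + 1) ^ 2 := by
      rw [div_pow, pertGain_sq, stepGain, Nat.cast_add_one, ← add_assoc]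
      field_simp
    _ ≤ p.γ i ^ 2 / p.γ' i ^ 2 * √((p.N' i + 1) * (p.N i + k + 1)) / (p.N i + k + 1) ^ 2 := by
      gcongr
      linarith [mul_nonneg hN' (add_nonneg hN hk)]
    _ = _ := by rw [Real.sqrt_mul (by positivity), ← mul_assoc]

variable (p) in
/-- A bound on the norms of the inputs when the estimates have norm at most `r` and the
perturbations have entries at most `ξ`. -/
noncomputable def inputBound (r ξ : ℝ) : ℝ :=
  r + (∑ i, p.γ' i) * √(n * ξ ^ 2)

theorem Valid.norm_add_norm_pertGain_smul_le (hp : p.Valid D ξ₁ ξ₂) {r : ℝ} {x v : Vec n}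
    (hx : ‖x‖ ≤ r) (hv : ∀ l, |v l| ≤ ξ₁) (i : Fin K) (k : ℕ) :
    ‖x‖ + ‖p.pertGain i k • v‖ ≤ p.inputBound r ξ₁ := by
  have hgain : ‖p.pertGain i k‖ ≤ ∑ j, p.γ' j := by
    rw [Real.norm_of_nonneg (hp.pertGain_nonneg i k)]
    exact (hp.pertGain_le i k).trans
      (Finset.single_le_sum (fun j _ => (hp.γ'_pos j).le) (Finset.mem_univ i))
  have hv : ‖v‖ ≤ √(n * ξ₁ ^ 2) :=
    Real.le_sqrt_of_sq_le (by simpa only [Fintype.card_fin] using norm_sq_le_of_abs_le hv)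
  rw [inputBound, norm_smul]
  exact add_le_add hx (mul_le_mul hgain hv (norm_nonneg _) ((norm_nonneg _).trans hgain))

end Gains

section ErrorRate

variable {K n : ℕ} (p : MSPSA K n) (S r ξ₁ ξ₂ : ℝ) (i : Fin K)

/-- The factor of `k ^ (-3 / 2)` in the noise term of the recursion for the mean squared error of
the `k`-th estimate, when `S` bounds the second moments of the observed costs. -/
noncomputable def noiseConst : ℝ :=
  4 * S * (p.γ i ^ 2 / p.γ' i ^ 2 * √(p.N' i + 1)) * (n * ξ₂)

/-- The factor of `k ^ (-1 / 2)` in the bound on the mean squared error of the `k`-th estimate, when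
all inputs in question have norm at most `r`. The second summand makes the bound valid for the
initial estimate. -/
noncomputable def errConst : ℝ :=
  2 * p.noiseConst S ξ₂ i + (2 * r) ^ 2 * √(p.N i + 1)

/-- The bound on the mean squared error of the estimate after `k` pairs of searches. -/
noncomputable def errBound (k : ℕ) : ℝ≥0∞ :=
  ENNReal.ofReal (p.errConst S r ξ₂ i / √(p.N i + k + 1))

/-- The factor of `k ^ (-1 / 2)` in the bound on the mean cost of the `k`-th pair of searches. -/
noncomputable def visitConst : ℝ :=
  4 * p.errConst S r ξ₂ i + 4 * (p.γ' i ^ 2 * (n * ξ₁ ^ 2))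

variable {p S r ξ₁ ξ₂} {D : Set (Vec n)} {I : Model K n} {Θ : Set (Params K n)} {σw : ℝ}

theorem noiseConst_nonneg (hS : 0 ≤ S) (hξ₂ : 0 ≤ ξ₂) : 0 ≤ p.noiseConst S ξ₂ i := by
  unfold noiseConst
  positivity

theorem errConst_nonneg (hS : 0 ≤ S) (hξ₂ : 0 ≤ ξ₂) : 0 ≤ p.errConst S r ξ₂ i := by
  have := noiseConst_nonneg (p := p) i hS hξ₂
  unfold errConst
  positivity

theorem visitConst_nonneg (hS : 0 ≤ S) (hξ₂ : 0 ≤ ξ₂) : 0 ≤ p.visitConst S r ξ₁ ξ₂ i := by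
  have := errConst_nonneg (p := p) (r := r) i hS hξ₂
  unfold visitConst
  positivity

theorem one_le_N_add_add_one (k : ℕ) : 1 ≤ (p.N i + k + 1 : ℝ) :=
  le_add_of_nonneg_left (by positivity)

theorem Valid.lintegral_pairCost_enorm_sub_sq_le_noiseConst (hp : p.Valid D ξ₁ ξ₂) (hξ₂ : 0 ≤ ξ₂)
    (hD : IsClosed D) (hconv : Convex ℝ D) (h : I.Admissible Θ D σw) (hstep : p.StepCondition I)
    (hS₀ : 0 ≤ S) (hr : ∀ x ∈ D, ‖x‖ ≤ r)
    (hS : ∀ x : Vec n, ‖x‖ ≤ p.inputBound r ξ₁ → ∀ i, ∫ z, I.obsCost x z ^ 2 ∂(I.nextLaw i) ≤ S)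
    (k : ℕ) {x : Vec n} (hx : x ∈ D) :
    ∫⁻ v, p.pairCost D I (fun y => ‖y - I.optInput i‖ₑ ^ 2) i (k + 1) x v ∂p.pertLaw ≤
      ENNReal.ofReal (1 - 1 / (p.N i + k + 1)) * ‖x - I.optInput i‖ₑ ^ 2 +
        ENNReal.ofReal (p.noiseConst S ξ₂ i * √(p.N i + k + 1) / (p.N i + k + 1) ^ 2) := by
  have hinput := fun (v : Vec n) (hv : ∀ l, |v l| ≤ ξ₁) =>
    hp.norm_add_norm_pertGain_smul_le (hr x hx) hv i (k + 1)
  refine (hp.lintegral_pairCost_enorm_sub_sq_le hξ₂ hD hconv h hstep i k.succ_pos x hS₀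
    fun v hv => ⟨hS _ ((norm_add_le _ _).trans (hinput v hv)) i,
      hS _ ((norm_sub_le _ _).trans (hinput v hv)) i⟩).trans ?_
  rw [← ofReal_norm, ← ENNReal.ofReal_pow (norm_nonneg _),
    ← ENNReal.ofReal_mul (one_sub_one_div_nonneg (one_le_N_add_add_one i k)), Nat.cast_add_one,
      ← add_assoc]
  refine (ENNReal.ofReal_le_ofReal (add_le_add_right ?_ _)).trans ENNReal.ofReal_add_le
  calc 4 * S * (p.stepGain i (k + 1) / p.pertGain i (k + 1)) ^ 2 * (n * ξ₂)
    _ ≤ 4 * S * (p.γ i ^ 2 / p.γ' i ^ 2 * √(p.N' i + 1) * √(p.N i + k + 1) /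
        (p.N i + k + 1) ^ 2) * (n * ξ₂) := by
      gcongr
      exact stepGain_div_pertGain_sq_le i k
    _ = _ := by
      rw [noiseConst]
      ring

theorem le_errBound_succ (hS₀ : 0 ≤ S) (hξ₂ : 0 ≤ ξ₂) (k : ℕ) :
    ENNReal.ofReal (1 - 1 / (p.N i + k + 1)) * p.errBound S r ξ₂ i k +
      ENNReal.ofReal (p.noiseConst S ξ₂ i * √(p.N i + k + 1) / (p.N i + k + 1) ^ 2) ≤
      p.errBound S r ξ₂ i (k + 1) := by
  have hnoise := noiseConst_nonneg (p := p) i hS₀ hξ₂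
  have herr := errConst_nonneg (p := p) (r := r) i hS₀ hξ₂
  have hm := one_le_N_add_add_one (p := p) i k
  have hfactor := one_sub_one_div_nonneg hm
  rw [errBound, ← ENNReal.ofReal_mul hfactor, ← ENNReal.ofReal_add (by positivity) (by positivity),
    errBound, Nat.cast_add_one, ← add_assoc (p.N i : ℝ)]
  exact ENNReal.ofReal_le_ofReal (one_sub_mul_div_sqrt_add_le hm
    (le_add_of_nonneg_right (by positivity)) herr)

theorem enorm_sub_sq_le_errBound_zero (hS₀ : 0 ≤ S) (hξ₂ : 0 ≤ ξ₂) {x y : Vec n} (hx : ‖x‖ ≤ r)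
    (hy : ‖y‖ ≤ r) : ‖x - y‖ₑ ^ 2 ≤ p.errBound S r ξ₂ i 0 := by
  have hnorm : ‖x - y‖ ^ 2 ≤ (2 * r) ^ 2 :=
    pow_le_pow_left₀ (norm_nonneg _) ((norm_sub_le x y).trans (by linarith)) 2
  rw [← ofReal_norm, ← ENNReal.ofReal_pow (norm_nonneg _), errBound]
  refine ENNReal.ofReal_le_ofReal (hnorm.trans ?_)
  rw [le_div_iff₀ (by positivity), Nat.cast_zero, add_zero]
  exact le_add_of_nonneg_left (mul_nonneg zero_le_two (noiseConst_nonneg i hS₀ hξ₂))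

theorem four_mul_errBound_add_le (hS₀ : 0 ≤ S) (hξ₂ : 0 ≤ ξ₂) (k : ℕ) :
    4 * p.errBound S r ξ₂ i k + 2 * p.pertBound ξ₁ i (k + 1) ≤
      ENNReal.ofReal (p.visitConst S r ξ₁ ξ₂ i * (1 / √(k + 1 : ℝ))) := by
  have herr := errConst_nonneg (p := p) (r := r) i hS₀ hξ₂
  rw [errBound, pertBound, ← ENNReal.ofReal_ofNat 4, ← ENNReal.ofReal_ofNat 2,
    ← ENNReal.ofReal_mul (by norm_num), ← ENNReal.ofReal_mul (by norm_num),
    ← ENNReal.ofReal_add (by positivity) (by positivity)]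
  refine ENNReal.ofReal_le_ofReal ?_
  calc 4 * (p.errConst S r ξ₂ i / √(p.N i + k + 1)) +
        2 * (2 * (p.pertGain i (k + 1) ^ 2 * (n * ξ₁ ^ 2)))
    _ ≤ 4 * (p.errConst S r ξ₂ i / √(k + 1 : ℝ)) +
        2 * (2 * (p.γ' i ^ 2 * (1 / √(k + 1 : ℝ)) * (n * ξ₁ ^ 2))) := by
      gcongr
      · exact le_add_of_nonneg_left (p.N i).cast_nonneg
      · exact pertGain_succ_sq_le i k
    _ = _ := by
      rw [visitConst]
      ring

theorem sum_four_mul_errBound_add_le (hS₀ : 0 ≤ S) (hξ₂ : 0 ≤ ξ₂) (T : ℕ) :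
    ∑ k ∈ Finset.range T, (4 * p.errBound S r ξ₂ i k + 2 * p.pertBound ξ₁ i (k + 1)) ≤
      ENNReal.ofReal (p.visitConst S r ξ₁ ξ₂ i * (2 * √T)) := by
  have hvisit := visitConst_nonneg (p := p) (r := r) (ξ₁ := ξ₁) i hS₀ hξ₂
  refine (Finset.sum_le_sum fun k _ => four_mul_errBound_add_le i hS₀ hξ₂ k).trans ?_
  rw [← ENNReal.ofReal_sum_of_nonneg fun k _ => by positivity, ← Finset.mul_sum]
  gcongr
  exact sum_one_div_sqrt_le T

end ErrorRate

end MSPSA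

/-! ### Input error and regret -/

namespace Realization

variable {K n : ℕ} {p : MSPSA K n} {I : Model K n} (R : Realization I p.ν) {Θ : Set (Params K n)}
  {D : Set (Vec n)} {σw ξ₁ ξ₂ M r : ℝ}

theorem inputMSE_le (hp : p.Valid D ξ₁ ξ₂) (hξ₂ : 0 ≤ ξ₂) (hD : IsClosed D) (hconv : Convex ℝ D)
    (h : I.Admissible Θ D σw) (hstep : p.StepCondition I) {S : ℝ} (hS₀ : 0 ≤ S)
    (hr : ∀ x ∈ D, ‖x‖ ≤ r)
    (hS : ∀ x : Vec n, ‖x‖ ≤ p.inputBound r ξ₁ → ∀ i, ∫ z, I.obsCost x z ^ 2 ∂(I.nextLaw i) ≤ S)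
    (T : ℕ) :
    R.inputMSE D T ≤ ∑ i, ENNReal.ofReal (p.visitConst S r ξ₁ ξ₂ i * (2 * √T)) := by
  have := hp.isProbabilityMeasure_pertLaw (n := n)
  have hproj := measurable_euclProj hD hconv
  obtain ⟨V, hV, hV₀⟩ := MSPSA.exists_isCostToGo h hproj ξ₁
    (fun i k x hx => hp.lintegral_pairCost_enorm_sub_sq_le_noiseConst i hξ₂ hD hconv h hstep hS₀
      hr hS k hx)
    (fun i => MSPSA.enorm_sub_sq_le_errBound_zero i hS₀ hξ₂ (hr _ (hp.xInit_mem i))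
      (hr _ (h.optInput_mem i)))
    (fun i => MSPSA.le_errBound_succ i hS₀ hξ₂) T
  exact (R.inputMSE_le_of_isCostToGo hp h hD hproj hV).trans (Finset.sum_le_sum fun i _ =>
    (hV₀ i).trans (MSPSA.sum_four_mul_errBound_add_le i hS₀ hξ₂ T))

theorem costGap_eq_sum_sub (D : Set (Vec n)) (T : ℕ) (ω : R.Ω) :
    R.costGap D T ω = ∑ t ∈ Finset.range T, (I.stageCost (R.s t ω) (R.input D t ω) -
      I.stageCost (R.s t ω) (I.optInput (R.s t ω))) :=
  Finset.sum_sub_distrib _ _ |>.symm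

theorem costGap_nonneg (h : I.Admissible Θ D σw) (T : ℕ) (ω : R.Ω) : 0 ≤ R.costGap D T ω := by
  rw [costGap_eq_sum_sub]
  exact Finset.sum_nonneg fun t _ => sub_nonneg.2 (h.stageCost_optInput_le _ _)

theorem costGap_le (h : I.Admissible Θ D σw) (hM : I.NormBound M) (T : ℕ) (ω : R.Ω) :
    R.costGap D T ω ≤
      M * ∑ t ∈ Finset.range T, ‖R.input D t ω - I.optInput (R.s t ω)‖ ^ 2 := by
  rw [costGap_eq_sum_sub, Finset.mul_sum]
  exact Finset.sum_le_sum fun t _ => h.stageCost_sub_stageCost_optInput_le hM _ _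

theorem measurable_costGap (h : I.Admissible Θ D σw) (hD : Measurable (euclProj D)) (T : ℕ) :
    Measurable (R.costGap D T) := by
  have hcost : ∀ t, Measurable fun ω => I.stageCost (R.s t ω) (R.input D t ω) := fun t =>
    measurable_apply_of_countable (F := fun i ω => I.stageCost i (R.input D t ω))
      (fun i => (h.measurable_stageCost i).comp (R.measurable_input hD t)) (R.meas_s t)
  have hopt : ∀ t, Measurable fun ω => I.stageCost (R.s t ω) (I.optInput (R.s t ω)) := fun t =>
    (measurable_of_countable fun i => I.stageCost i (I.optInput i)).comp (R.meas_s t)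
  exact (Finset.measurable_fun_sum _ fun t _ => hcost t).sub
    (Finset.measurable_fun_sum _ fun t _ => hopt t)

theorem norm_input_le (hp : p.Valid D ξ₁ ξ₂) (hD : IsClosed D) (hr : ∀ x ∈ D, ‖x‖ ≤ r) (t : ℕ)
    {ω : R.Ω} (hω : ∀ i k l, |R.pert ω i k l| ≤ ξ₁) : ‖R.input D t ω‖ ≤ p.inputBound r ξ₁ := by
  have hest : ‖(R.memory D t ω).est (R.s t ω)‖ ≤ r :=
    hr _ (p.memory_est_mem I _ _ hD hp.xInit_mem _ t _)
  have hstep := fun k => hp.norm_add_norm_pertGain_smul_le hest (hω (R.s t ω) k) (R.s t ω) k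
  change ‖p.input (R.memory D t ω) (R.pert ω) (R.s t ω)‖ ≤ _
  cases hflag : (R.memory D t ω).flag (R.s t ω)
  · rw [p.input_of_flag_false hflag]
    exact (norm_add_le _ _).trans (hstep _)
  · rw [p.input_of_flag_true hflag]
    exact (norm_sub_le _ _).trans (hstep _)

theorem integrable_costGap (hp : p.Valid D ξ₁ ξ₂) (hD : IsCompact D) (hconv : Convex ℝ D)
    (h : I.Admissible Θ D σw) (hM : I.NormBound M) (hM₀ : 0 ≤ M) (T : ℕ) :
    Integrable (R.costGap D T) R.μ := by
  have := R.prob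
  obtain ⟨r, hr⟩ := hD.isBounded.exists_norm_le
  refine Integrable.of_bound (R.measurable_costGap h
    (measurable_euclProj hD.isClosed hconv) T).aestronglyMeasurable
    (M * ∑ _t ∈ Finset.range T, (p.inputBound r ξ₁ + r) ^ 2) ?_
  filter_upwards [R.ae_abs_pert_le hp] with ω hω
  rw [Real.norm_of_nonneg (R.costGap_nonneg h T ω)]
  refine (R.costGap_le h hM T ω).trans ?_
  gcongr
  exact norm_sub_le_of_le (R.norm_input_le hp hD.isClosed hr _ hω) (hr _ (h.optInput_mem _))

theorem regret_le_mul (hp : p.Valid D ξ₁ ξ₂) (hD : IsCompact D) (hconv : Convex ℝ D)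
    (h : I.Admissible Θ D σw) (hM : I.NormBound M) (hM₀ : 0 ≤ M) {T : ℕ} {B : ℝ} (hB : 0 ≤ B)
    (hmse : R.inputMSE D T ≤ ENNReal.ofReal B) : R.regret D T ≤ M * B := by
  have hproj := measurable_euclProj hD.isClosed hconv
  refine (ENNReal.ofReal_le_ofReal_iff (mul_nonneg hM₀ hB)).1 ?_
  calc ENNReal.ofReal (R.regret D T)
    _ = ∫⁻ ω, ENNReal.ofReal (R.costGap D T ω) ∂(R.μ) :=
      ofReal_integral_eq_lintegral_ofReal (R.integrable_costGap hp hD hconv h hM hM₀ T)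
        (ae_of_all _ (R.costGap_nonneg h T))
    _ ≤ ∫⁻ ω, ENNReal.ofReal M *
        ∑ t ∈ Finset.range T, ‖R.input D t ω - I.optInput (R.s t ω)‖ₑ ^ 2 ∂(R.μ) := by
      gcongr with ω
      refine (ENNReal.ofReal_le_ofReal (R.costGap_le h hM T ω)).trans_eq ?_
      rw [ENNReal.ofReal_mul hM₀, ENNReal.ofReal_sum_of_nonneg fun t _ => by positivity]
      simp only [ENNReal.ofReal_pow (norm_nonneg _), ofReal_norm]
    _ = ENNReal.ofReal M * R.inputMSE D T :=
      lintegral_const_mul _ (Finset.measurable_fun_sum _ fun t _ =>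
        R.measurable_enorm_input_sub_optInput_sq hproj t)
    _ ≤ ENNReal.ofReal (M * B) := by
      rw [ENNReal.ofReal_mul hM₀]
      gcongr

end Realization

theorem MSPSA.Valid.exists_inputMSE_le {K n : ℕ} {p : MSPSA K n} {Θ : Set (Params K n)}
    {D : Set (Vec n)} {σw ξ₁ ξ₂ : ℝ} (hp : p.Valid D ξ₁ ξ₂) (hξ₂ : 0 ≤ ξ₂) (hΘ : IsCompact Θ)
    (hD : IsCompact D) (hconv : Convex ℝ D) :
    ∃ C > (0 : ℝ), ∀ I : Model K n, I.Admissible Θ D σw → p.StepCondition I →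
      ∀ (R : Realization I p.ν) (T : ℕ), R.inputMSE D T ≤ ENNReal.ofReal (C * √T) := by
  obtain ⟨M, -, hM⟩ := Model.exists_normBound hΘ
  obtain ⟨r, hr⟩ := hD.isBounded.exists_norm_le
  let R₀ := p.inputBound r ξ₁
  let S := 2 * R₀ ^ 2 * ((M * R₀ + M) ^ 2 + n * σw ^ 2)
  have hS₀ : 0 ≤ S := by positivity
  have hvisit := fun i => p.visitConst_nonneg (r := r) (ξ₁ := ξ₁) i hS₀ hξ₂
  refine ⟨2 * ∑ i, p.visitConst S r ξ₁ ξ₂ i + 1,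
    add_pos_of_nonneg_of_pos (mul_nonneg zero_le_two (Finset.sum_nonneg fun i _ => hvisit i))
      one_pos, fun I h hstep R T => ?_⟩
  refine (R.inputMSE_le hp hξ₂ hD.isClosed hconv h hstep hS₀ hr
    (fun x hx i => h.integral_sq_obsCost_le (hM I h.θ_mem) hx i) T).trans ?_
  rw [← ENNReal.ofReal_sum_of_nonneg fun i _ => mul_nonneg (hvisit i) (by positivity),
    ← Finset.sum_mul]
  exact ENNReal.ofReal_le_ofReal (by linarith [Real.sqrt_nonneg T])

theorem mainTheorem6 (K n : ℕ) (Θ : Set (Params K n)) (hΘ : IsCompact Θ)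
    (D : Set (Vec n)) (hD : IsCompact D) (hDconv : Convex ℝ D)
    (σw ξ₁ ξ₂ : ℝ) (hσw : 0 < σw) (hξ₁ : 0 < ξ₁) (hξ₂ : 0 < ξ₂)
    (p : MSPSA K n) (hp : p.Valid D ξ₁ ξ₂) :
    (∀ I : Model K n, I.Admissible Θ D σw → ∀ (R : Realization I p.ν) (T : ℕ),
      Integrable (R.costGap D T) R.μ) ∧
    ∃ C > (0 : ℝ), ∃ C' > (0 : ℝ), ∀ T : ℕ,
      p.worstInputMSE D {I | I.Admissible Θ D σw ∧ p.StepCondition I} T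
        ≤ ENNReal.ofReal (C * Real.sqrt T) ∧
      p.worstRegret D {I | I.Admissible Θ D σw ∧ p.StepCondition I} T
        ≤ ((C' * Real.sqrt T : ℝ) : EReal) := by
  obtain ⟨M, hM₀, hM⟩ := Model.exists_normBound hΘ
  obtain ⟨C, hC, hmse⟩ := hp.exists_inputMSE_le (σw := σw) hξ₂.le hΘ hD hDconv
  refine ⟨fun I h R T => R.integrable_costGap hp hD hDconv h (hM I h.θ_mem) hM₀ T,
    C, hC, (M + 1) * C, by positivity, fun T => ⟨?_, ?_⟩⟩
  · exact iSup₂_le fun I hI => iSup_le fun R => hmse I hI.1 hI.2 R T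
  · refine iSup₂_le fun I hI => iSup_le fun R => EReal.coe_le_coe_iff.2 ?_
    have hregret : R.regret D T ≤ M * (C * √T) :=
      R.regret_le_mul hp hD hDconv hI.1 (hM I hI.1.θ_mem) hM₀ (by positivity)
        (hmse I hI.1 hI.2 R T)
    linarith [mul_nonneg hC.le (Real.sqrt_nonneg T)]
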